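/- Let $B\in(0,1)$ and let $\sigma_1,\sigma_2,\sigma_3$ be the Pauli matrices. For $N\ge 1$ let $$H_N=-\frac{1}{2N}\sum_{i,j=1}^N\sigma_3(i)\sigma_3(j)-B\sum_{j=1}^N\sigma_1(j)$$ be the quantum Curie–Weiss Hamiltonian (with $J=1$) on $(\mathbb C^2)^{\otimes N}$, where $\sigma_k(j)$ is $\sigma_k$ acting in the $j$-th slot. Let $B^3\subset\mathbb R^3$ be the closed unit ball (identified with the state space of $M_2(\mathbb C)$ via $(x,y,z)\mapsto\frac12(1+x\sigma_1+y\sigma_2+z\sigma_3)$). Let $S_N$ be the symmetrizer on $M_2(\mathbb C)^{\otimes N}$, $S_N(a_1\otimes\cdots\otimes a_N)=\frac1{N!}\sum_{\pi}a_{\pi(1)}\otimes\cdots\otimes a_{\pi(N)}$. Let $Q_{1/N}$ be the linear map from complex polynomials in $(x_1,x_2,x_3)=(x,y,z)$ on $B^3$ to $M_2(\mathbb C)^{\otimes N}$ given on monomials by $$Q_{1/N}(x_{j_1}\cdots x_{j_L})=S_N\big(S_L(\sigma_{j_1}\otimes\cdots\otimes\sigma_{j_L})\otimes 1\otimes\cdots\otimes1\big)\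 \text{ if } N\ge L,\qquad 0\ \text{ if } N<L,$$ so that $Q_{1/N}(1)=1$. Let $h(x,y,z)=-(\tfrac12z^2+Bx)$ on $B^3$ and $\mathbf x_\pm=(B,0,\pm\sqrt{1-B^2})$. Then: 1. For every $N\ge1$ the ground state of $H_N$ (a unit eigenvector for the lowest eigenvalue) exists and is unique up to a phase. 2. The points $\mathbf x_+\neq\mathbf x_-$ are exactly the points of $B^3$ at which $h$ attains its absolute minimum. 3. If $\Psi_N$ is a ground state of $H_N$ for every $N\ge1$, then for every polynomial $f$ on $B^3$ $$\lim_{N\to\infty}\langle\Psi_N,Q_{1/N}(f)\Psi_N\rangle=\tfrac12\big(f(\mathbf x_+)+f(\mathbf x_-)\big).$$ 4. The limit functional $\omega(g)=\frac12(g(\mathbf x_+)+g(\mathbf x_-))$ on $C(B^3)$ is a state and a classical ground state, that is, a convex combination of Dirac measures at absolute minima of $h$; it is invariant under the $\mathbb Z_2$-symmetry $g(x,y,z)\mapsto g(x,-y,-z)$, and it is mixed, that is, not an extreme point of the set of states of $C(B^3)$. -/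

import Mathlib

open Filter Topology

noncomputable section

namespace CurieWeiss

/-- The algebra `M₂(ℂ)`. -/
abbrev M2 : Type := Matrix (Fin 2) (Fin 2) ℂ

/-- The Hilbert space `(ℂ²)^{⊗N}`, written in its product orthonormal basis, which is indexed by
the spin configurations `Fin N → Fin 2`. -/
abbrev SpinSpace (N : ℕ) : Type := EuclideanSpace ℂ (Fin N → Fin 2)

/-- The algebra `M₂(ℂ)^{⊗N}` of operators on `(ℂ²)^{⊗N}`, as matrices in the product basis. -/
abbrev SpinMat (N : ℕ) : Type := Matrix (Fin N → Fin 2) (Fin N → Fin 2) ℂ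

/-- The elementary tensor `a₁ ⊗ ⋯ ⊗ a_N` (the Kronecker product). -/
def elemTensor {N : ℕ} (a : Fin N → M2) : SpinMat N :=
  Matrix.of fun s t => ∏ i, a i (s i) (t i)

/-- `(a₁ ⊗ ⋯ ⊗ a_N)(v₁ ⊗ ⋯ ⊗ v_N) = a₁v₁ ⊗ ⋯ ⊗ a_N v_N`. -/
theorem elemTensor_mulVec {N : ℕ} (a : Fin N → M2) (v : Fin N → Fin 2 → ℂ) :
    (elemTensor a).mulVec (fun t => ∏ i, v i (t i)) =
      fun s => ∏ i, ((a i).mulVec (v i)) (s i) := by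
  funext s
  simp only [Matrix.mulVec, dotProduct, elemTensor, Matrix.of_apply, ← Finset.prod_mul_distrib]
  rw [Finset.prod_univ_sum, Fintype.piFinset_univ]

theorem elemTensor_one {N : ℕ} : elemTensor (fun _ : Fin N => (1 : M2)) = 1 := by
  ext s t
  by_cases h : s = t
  · subst h; simp [elemTensor]
  · obtain ⟨i, hi⟩ := Function.ne_iff.mp h
    rw [Matrix.one_apply_ne h]
    exact Finset.prod_eq_zero (Finset.mem_univ i) (Matrix.one_apply_ne hi)

/-- The symmetrizer `S_N` on `M₂(ℂ)^{⊗N}`. -/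
def symmetrizer (N : ℕ) : SpinMat N →ₗ[ℂ] SpinMat N :=
  ((N.factorial : ℂ)⁻¹) • ∑ σ : Equiv.Perm (Fin N),
    (Matrix.reindexLinearEquiv ℂ ℂ
      (Equiv.arrowCongr σ.symm (Equiv.refl (Fin 2)))
      (Equiv.arrowCongr σ.symm (Equiv.refl (Fin 2)))).toLinearMap

/-- `S_N (a₁ ⊗ ⋯ ⊗ a_N) = (1/N!) ∑_σ a_{σ(1)} ⊗ ⋯ ⊗ a_{σ(N)}`. -/
theorem symmetrizer_elemTensor {N : ℕ} (a : Fin N → M2) :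
    symmetrizer N (elemTensor a) =
      ((N.factorial : ℂ)⁻¹) • ∑ σ : Equiv.Perm (Fin N), elemTensor (fun i => a (σ i)) := by
  simp only [symmetrizer, LinearMap.smul_apply, LinearMap.sum_apply]
  congr 1
  refine Finset.sum_congr rfl fun σ _ => ?_
  ext s t
  simp only [LinearEquiv.coe_coe, Matrix.coe_reindexLinearEquiv, Matrix.reindex_apply,
    Matrix.submatrix_apply, elemTensor, Matrix.of_apply]
  rw [← Equiv.prod_comp σ]
  simp [Equiv.arrowCongr]

/-- `b ↦ b ⊗ 1 ⊗ ⋯ ⊗ 1` from `M₂(ℂ)^{⊗M}` to `M₂(ℂ)^{⊗N}`, where `M ≤ N`. -/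
def padOne {M N : ℕ} (h : M ≤ N) (b : SpinMat M) : SpinMat N :=
  Matrix.of fun s t => b (fun i => s (Fin.castLE h i)) (fun i => t (Fin.castLE h i)) *
    ∏ i : Fin N with M ≤ i.val, (1 : M2) (s i) (t i)

theorem padOne_elemTensor {M N : ℕ} (h : M ≤ N) (a : Fin M → M2) :
    padOne h (elemTensor a) =
      elemTensor (fun i : Fin N => if hi : i.val < M then a ⟨i.val, hi⟩ else 1) := by
  ext s t
  simp only [padOne, elemTensor, Matrix.of_apply]
  rw [← Finset.prod_filter_mul_prod_filter_not Finset.univ (fun i : Fin N => i.val < M)]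
  congr 1
  · symm
    refine Finset.prod_bij' (fun i hi => ⟨i.val, (Finset.mem_filter.mp hi).2⟩)
      (fun i _ => Fin.castLE h i) ?_ ?_ ?_ ?_ ?_
    · intro i hi; simp
    · intro i hi; simp
    · intro i hi; rfl
    · intro i hi; rfl
    · intro i hi
      rw [dif_pos (Finset.mem_filter.mp hi).2]
      rfl
  · refine Finset.prod_congr ?_ ?_
    · ext i; simp
    · intro i hi
      rw [dif_neg (by simpa using (Finset.mem_filter.mp hi).2)]

/-- `S_{M,N}(b) = S_N(b ⊗ 1 ⊗ ⋯ ⊗ 1)`. -/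
def symmetrizerFrom {M N : ℕ} (h : M ≤ N) (b : SpinMat M) : SpinMat N :=
  symmetrizer N (padOne h b)

/-- The Pauli matrices `σ₁, σ₂, σ₃` (indexed by `0, 1, 2`). -/
def pauli : Fin 3 → M2 :=
  ![!![0, 1; 1, 0], !![0, -Complex.I; Complex.I, 0], !![1, 0; 0, -1]]

/-- `σ_k(j) = 1 ⊗ ⋯ ⊗ σ_k ⊗ ⋯ ⊗ 1`, with `σ_k` in the `j`-th slot. -/
def pauliAt {N : ℕ} (k : Fin 3) (j : Fin N) : SpinMat N :=
  elemTensor (Function.update (fun _ => 1) j (pauli k))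

/-- The quantum Curie-Weiss Hamiltonian
`-(J/(2N)) ∑_{i,j} σ₃(i)σ₃(j) - B ∑_j σ₁(j)`. -/
def hamiltonian (J B : ℝ) (N : ℕ) : SpinMat N :=
  -((J / (2 * N) : ℝ) : ℂ) • ∑ i : Fin N, ∑ j : Fin N, pauliAt 2 i * pauliAt 2 j
    - (B : ℂ) • ∑ j : Fin N, pauliAt 0 j

/-- `ψ` is a unit eigenvector of `A` for its lowest eigenvalue. -/
def IsGroundState {N : ℕ} (A : SpinMat N) (ψ : SpinSpace N) : Prop :=
  ‖ψ‖ = 1 ∧ ∃ E : ℝ, Matrix.toEuclideanLin A ψ = (E : ℂ) • ψ ∧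
    ∀ μ : ℝ, Module.End.HasEigenvalue (Matrix.toEuclideanLin A) (μ : ℂ) → E ≤ μ

/-- `S_{L,N}(σ_{j₁} ⊗ₛ ⋯ ⊗ₛ σ_{j_L})` for the word `j₁, …, j_L`, and `0` if `N < L`. -/
def quantizeWord (N : ℕ) (l : List (Fin 3)) : SpinMat N :=
  if h : l.length ≤ N then
    symmetrizerFrom h (symmetrizer l.length (elemTensor fun i => pauli (l.get i)))
  else 0

/-- The quantization map `Q_{1/N}` on complex polynomials in `(x, y, z)`: the linear map whose
value at a monomial `x_{j₁} ⋯ x_{j_L}` is `quantizeWord N [j₁, …, j_L]`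
(see `quantize_word`: the order of the factors is irrelevant). -/
def quantize (N : ℕ) : MvPolynomial (Fin 3) ℂ →ₗ[ℂ] SpinMat N :=
  (MvPolynomial.basisMonomials (Fin 3) ℂ).constr ℂ fun α =>
    quantizeWord N (Multiset.sort (Finsupp.toMultiset α) (· ≤ ·))

theorem symmetrizer_comp_perm {N : ℕ} (a : Fin N → M2) (τ : Equiv.Perm (Fin N)) :
    symmetrizer N (elemTensor fun i => a (τ i)) = symmetrizer N (elemTensor a) := by
  rw [symmetrizer_elemTensor, symmetrizer_elemTensor]
  congr 1
  exact Equiv.sum_comp (Equiv.mulLeft τ) (fun σ => elemTensor fun i => a (σ i))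

theorem quantizeWord_perm (N : ℕ) {l l' : List (Fin 3)} (h : l.Perm l') :
    quantizeWord N l = quantizeWord N l' := by
  have key : ∀ (L L' : ℕ) (f : Fin L → Fin 3) (g : Fin L' → Fin 3) (e : Fin L ≃ Fin L'),
      (∀ i, g (e i) = f i) →
      (if h : L ≤ N then
        symmetrizerFrom h (symmetrizer L (elemTensor fun i => pauli (f i))) else 0) =
      (if h : L' ≤ N then
        symmetrizerFrom h (symmetrizer L' (elemTensor fun i => pauli (g i))) else 0) := by
    intro L L' f g e hfg
    obtain rfl : L = L' := by simpa using Fintype.card_congr e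
    have h1 : (fun i => pauli (f i)) = fun i => pauli (g (e i)) := by
      funext i; rw [hfg]
    rw [h1, symmetrizer_comp_perm (fun i => pauli (g i)) e]
  exact key l.length l'.length l.get l'.get
    (Equiv.ofBijective h.idxBij ⟨h.idxBij_injective, h.idxBij_surjective⟩)
    fun i => h.getElem_idxBij_eq_getElem i

/-- `Q_{1/N}(x_{j₁} ⋯ x_{j_L})` is given by the word `j₁, …, j_L`, in any order. -/
theorem quantize_word (N : ℕ) (l : List (Fin 3)) :
    quantize N (l.map MvPolynomial.X).prod = quantizeWord N l := by
  have h1 : (l.map (MvPolynomial.X : Fin 3 → MvPolynomial (Fin 3) ℂ)).prod =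
      MvPolynomial.basisMonomials (Fin 3) ℂ (Multiset.toFinsupp (l : Multiset (Fin 3))) := by
    rw [MvPolynomial.coe_basisMonomials]
    induction l with
    | nil => simp
    | cons j l ih =>
      rw [List.map_cons, List.prod_cons, ih, ← Multiset.cons_coe, ← Multiset.singleton_add,
        map_add, Multiset.toFinsupp_singleton, MvPolynomial.X, MvPolynomial.monomial_mul, one_mul]
  rw [h1, quantize, Module.Basis.constr_basis, Multiset.toFinsupp_toMultiset]
  refine quantizeWord_perm N (Multiset.coe_eq_coe.mp ?_)
  rw [Multiset.sort_eq]

/-- `Q_{1/N}(1) = 1`. -/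
theorem quantize_one (N : ℕ) : quantize N 1 = 1 := by
  have h := quantize_word N []
  rw [List.map_nil, List.prod_nil] at h
  have h0 : ([] : List (Fin 3)).length ≤ N := Nat.zero_le N
  rw [h, quantizeWord, dif_pos h0, symmetrizer_elemTensor]
  simp only [symmetrizerFrom, List.length_nil, Nat.factorial_zero, Nat.cast_one, inv_one,
    one_smul, Finset.univ_unique, Finset.sum_singleton]
  rw [padOne_elemTensor]
  simp only [Nat.not_lt_zero, dif_neg, not_false_eq_true]
  rw [symmetrizer_elemTensor]
  simp only [elemTensor_one, Finset.sum_const, Finset.card_univ, Fintype.card_perm,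
    Fintype.card_fin]
  rw [← Nat.cast_smul_eq_nsmul ℂ, smul_smul, inv_mul_cancel₀, one_smul]
  exact_mod_cast Nat.factorial_ne_zero N

/-- The closed unit ball `B³`, identified with the state space of `M₂(ℂ)` by letting `(x, y, z)`
correspond to the density matrix `(1 + xσ₁ + yσ₂ + zσ₃)/2`. -/
abbrev Ball3 : Type := Metric.closedBall (0 : EuclideanSpace ℝ (Fin 3)) 1

/-- The restriction of a polynomial to `B³`. -/
def polyFun (f : MvPolynomial (Fin 3) ℂ) : C(Ball3, ℂ) where
  toFun x := MvPolynomial.eval (fun i => ((x.1 i : ℝ) : ℂ)) f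
  continuous_toFun := by
    refine (MvPolynomial.continuous_eval f).comp (continuous_pi fun i => ?_)
    fun_prop

/-- A polynomial is determined by the function that it defines on `B³`. -/
theorem polyFun_injective : Function.Injective polyFun := by
  intro f g hfg
  refine MvPolynomial.funext_set (fun _ => (fun r : ℝ => (r : ℂ)) '' Set.Icc 0 (1 / 2))
    (fun _ => (Set.Icc_infinite (by norm_num)).image Complex.ofReal_injective.injOn) ?_
  intro x hx
  choose r hr hrx using fun i => hx i (Set.mem_univ i)
  have hb : ‖(!₂[r 0, r 1, r 2] : EuclideanSpace ℝ (Fin 3))‖ ≤ 1 := by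
    rw [EuclideanSpace.norm_eq, Real.sqrt_le_iff]
    simp [Fin.sum_univ_three]
    nlinarith [(hr 0).1, (hr 0).2, (hr 1).1, (hr 1).2, (hr 2).1, (hr 2).2]
  have h := congrArg (fun F : C(Ball3, ℂ) => F ⟨!₂[r 0, r 1, r 2], by simpa using hb⟩) hfg
  have hx' : (fun i => (((!₂[r 0, r 1, r 2] : EuclideanSpace ℝ (Fin 3)) i : ℝ) : ℂ)) = x := by
    funext i
    rw [← hrx i]
    fin_cases i <;> simp
  simpa only [polyFun, ContinuousMap.coe_mk, hx'] using h

/-- The classical Curie-Weiss Hamiltonian `-(J z²/2 + B x)` on `B³`. -/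
def classicalHamiltonian (J B : ℝ) (p : Ball3) : ℝ :=
  -(J / 2 * p.1 2 ^ 2 + B * p.1 0)

/-- The point `x₊ = (B, 0, √(1 - B²))`. -/
def xPlus (B : ℝ) (hB : B ∈ Set.Ioo (0 : ℝ) 1) : Ball3 :=
  ⟨!₂[B, 0, √(1 - B ^ 2)], by
    have h : 0 ≤ 1 - B ^ 2 := by nlinarith [hB.1, hB.2]
    simp [EuclideanSpace.norm_eq, Fin.sum_univ_three, Real.sq_sqrt h]⟩

/-- The point `x₋ = (B, 0, -√(1 - B²))`. -/
def xMinus (B : ℝ) (hB : B ∈ Set.Ioo (0 : ℝ) 1) : Ball3 :=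
  ⟨!₂[B, 0, -√(1 - B ^ 2)], by
    have h : 0 ≤ 1 - B ^ 2 := by nlinarith [hB.1, hB.2]
    simp [EuclideanSpace.norm_eq, Fin.sum_univ_three, Real.sq_sqrt h]⟩

/-- The states of the C*-algebra `C(B³)`: its normalized positive linear functionals. -/
def states : Set (C(Ball3, ℂ) →L[ℂ] ℂ) :=
  {ω | ω 1 = 1 ∧ ∀ f : C(Ball3, ℂ), 0 ≤ (ω (star f * f)).re ∧ (ω (star f * f)).im = 0}

/-- The classical ground states: convex combinations of Dirac measures at the points of `B³`
where the classical Hamiltonian assumes its absolute minimum. -/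
def classicalGroundStates (J B : ℝ) : Set (C(Ball3, ℂ) →L[ℂ] ℂ) :=
  convexHull ℝ ((fun p : Ball3 => ContinuousMap.evalCLM ℂ p) ''
    {p | ∀ q, classicalHamiltonian J B p ≤ classicalHamiltonian J B q})

/-- The map `(x, y, z) ↦ (x, -y, -z)` of `B³`. -/
def parity : C(Ball3, Ball3) where
  toFun p := ⟨!₂[p.1 0, -p.1 1, -p.1 2], by
    have := mem_closedBall_zero_iff.mp p.2
    rw [mem_closedBall_zero_iff]
    simpa [EuclideanSpace.norm_eq, Fin.sum_univ_three] using this⟩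
  continuous_toFun := by
    refine Continuous.subtype_mk ?_ _
    refine (PiLp.continuous_toLp 2 _).comp (continuous_pi fun i => ?_)
    fin_cases i <;> simp <;> fun_prop

end CurieWeiss

end

/-!
The whole argument runs through the mean spin operators `S_k = (1/N) ∑_j σ_k(j)`, in terms of which
`H_N = -N (S₃²/2 + B S₁)`.

*Uniqueness of the ground state* is the Perron-Frobenius argument: in the product basis the
off-diagonal entries of `H_N` are `-B` at single spin flips, which connect all configurations. Hence
the vector of moduli of a ground state is a ground state, no coordinate of a ground state vanishes
(`IsGroundState.apply_ne_zero`), and two ground states are proportional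
(`IsGroundState.exists_eq_smul`). In particular every unitary symmetry of `H_N` multiplies the
ground state by a phase, so that expectations in the ground state are invariant under permutations
of the slots and under the total spin flip.

*Concentration.* The Casimir bound `S₁² + S₂² + S₃² ≤ 1 + 2/N` (`sum_norm_meanSpin_sq_le`) gives
`H_N / N ≥ (S₁ - B)²/2 + S₂²/2 - (1 + B²)/2 - 1/N`, while a product state has energy at most
`-N (1 + B²)/2` (`exists_re_inner_hamiltonian_le`). So `S₁Ψ ≈ BΨ` and `S₂Ψ ≈ 0` in norm, with
errors of order `N^(-1/2)`, and the eigenvalue equation of `H_N` turns this into `S₃²Ψ ≈ (1 - B²)Ψ`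
(`IsGroundState.norm_meanSpin_sub_le`).

*Classical limit.* `Q_{1/N}` of a monomial is an average of Pauli strings with few letters
(`quantizeWord_eq`). By permutation symmetry a letter `σ_k` of such a string may be replaced by `S_k`
up to an error of order `1/N` (`norm_inner_pauliString_sub_le`), and the mean spin operators then act
on `Ψ` as above. Letters are removed until at most one `σ₃` is left, whose expectation vanishes by
the spin flip symmetry; the outcome is the mean of the values of the monomial at
`(B, 0, ±√(1 - B²))` (`IsGroundState.norm_inner_pauliString_sub_limitValue_le`).

The classical minimizers come from `h + (1 + B²)/2 ≥ ((x - B)² + y²)/2` on the unit ball, the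
classical form of the concentration estimate.
-/

noncomputable section

namespace CurieWeiss

open Matrix

variable {N : ℕ}

/-! ### Pauli strings and their action on vectors -/

theorem toEuclideanLin_apply_apply (A : SpinMat N) (ψ : SpinSpace N) (s : Fin N → Fin 2) :
    (toEuclideanLin A ψ) s = ∑ t, A s t * ψ t := by
  rfl

theorem toEuclideanLin_mul (A B : SpinMat N) (ψ : SpinSpace N) :
    toEuclideanLin (A * B) ψ = toEuclideanLin A (toEuclideanLin B ψ) := by
  ext s
  simp [toEuclideanLin, Matrix.mulVec_mulVec]

theorem toEuclideanLin_one_apply (ψ : SpinSpace N) :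
    toEuclideanLin (1 : SpinMat N) ψ = ψ := by
  ext s
  simp [toEuclideanLin]

theorem inner_toEuclideanLin_left {A : SpinMat N} (hA : A.IsHermitian) (φ ψ : SpinSpace N) :
    inner ℂ (toEuclideanLin A φ) ψ = inner ℂ φ (toEuclideanLin A ψ) :=
  (isSymmetric_toEuclideanLin_iff.mpr hA) φ ψ

theorem elemTensor_mul (a b : Fin N → M2) :
    elemTensor a * elemTensor b = elemTensor fun i => a i * b i := by
  ext s t
  simp only [elemTensor, Matrix.mul_apply, Matrix.of_apply, ← Finset.prod_mul_distrib]
  rw [Finset.prod_univ_sum, Fintype.piFinset_univ]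

theorem elemTensor_isHermitian {a : Fin N → M2} (ha : ∀ i, (a i).IsHermitian) :
    (elemTensor a).IsHermitian := by
  ext s t
  simp only [elemTensor, Matrix.conjTranspose_apply, Matrix.of_apply, star_prod]
  exact Finset.prod_congr rfl fun i _ => (ha i).apply _ _

/-- The letters of a Pauli string: `none` stands for the identity, `some k` for `σ_k`. -/
def letter : Option (Fin 3) → M2
  | none => 1
  | some k => pauli k

theorem pauli_isHermitian (k : Fin 3) : (pauli k).IsHermitian := by
  ext i j
  fin_cases k <;> fin_cases i <;> fin_cases j <;> simp [pauli]

theorem pauli_mul_self (k : Fin 3) : pauli k * pauli k = 1 := by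
  ext i j
  fin_cases k <;> fin_cases i <;> fin_cases j <;> simp [pauli, Matrix.mul_apply]

theorem letter_isHermitian (o : Option (Fin 3)) : (letter o).IsHermitian := by
  cases o with
  | none => exact Matrix.isHermitian_one
  | some k => exact pauli_isHermitian k

theorem letter_mul_self (o : Option (Fin 3)) : letter o * letter o = 1 := by
  cases o with
  | none => exact one_mul _
  | some k => exact pauli_mul_self k

/-- The Pauli string with letter `a i` in the `i`-th slot. -/
def pauliString (a : Fin N → Option (Fin 3)) : SpinMat N :=
  elemTensor fun i => letter (a i)

theorem pauliString_isHermitian (a : Fin N → Option (Fin 3)) : (pauliString a).IsHermitian :=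
  elemTensor_isHermitian fun i => letter_isHermitian (a i)

theorem pauliString_mul_self (a : Fin N → Option (Fin 3)) : pauliString a * pauliString a = 1 := by
  rw [pauliString, elemTensor_mul]
  simp only [letter_mul_self, elemTensor_one]

theorem norm_pauliString_apply (a : Fin N → Option (Fin 3)) (ψ : SpinSpace N) :
    ‖toEuclideanLin (pauliString a) ψ‖ = ‖ψ‖ := by
  have h : inner ℂ (toEuclideanLin (pauliString a) ψ) (toEuclideanLin (pauliString a) ψ) =
      inner ℂ ψ ψ := by
    rw [inner_toEuclideanLin_left (pauliString_isHermitian a), ← toEuclideanLin_mul,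
      pauliString_mul_self, toEuclideanLin_one_apply]
  rw [inner_self_eq_norm_sq_to_K, inner_self_eq_norm_sq_to_K] at h
  have h' : ‖toEuclideanLin (pauliString a) ψ‖ ^ 2 = ‖ψ‖ ^ 2 := by exact_mod_cast h
  exact (sq_eq_sq₀ (norm_nonneg _) (norm_nonneg _)).mp h'

theorem norm_inner_pauliString_le (a : Fin N → Option (Fin 3)) (ψ φ : SpinSpace N) :
    ‖inner ℂ ψ (toEuclideanLin (pauliString a) φ)‖ ≤ ‖ψ‖ * ‖φ‖ := by
  simpa only [norm_pauliString_apply] using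
    norm_inner_le_norm (𝕜 := ℂ) ψ (toEuclideanLin (pauliString a) φ)

theorem pauliAt_eq_pauliString (k : Fin 3) (j : Fin N) :
    pauliAt k j = pauliString (Function.update (fun _ => none) j (some k)) := by
  rw [pauliAt, pauliString]
  congr 1
  funext i
  by_cases h : i = j
  · subst h; simp [letter]
  · simp [h, letter]

theorem pauliAt_isHermitian (k : Fin 3) (j : Fin N) : (pauliAt k j).IsHermitian := by
  rw [pauliAt_eq_pauliString]
  exact pauliString_isHermitian _

theorem norm_pauliAt_apply (k : Fin 3) (j : Fin N) (ψ : SpinSpace N) :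
    ‖toEuclideanLin (pauliAt k j) ψ‖ = ‖ψ‖ := by
  rw [pauliAt_eq_pauliString, norm_pauliString_apply]

theorem pauliString_mul_pauliAt {a : Fin N → Option (Fin 3)} {j : Fin N} (hj : a j = none)
    (k : Fin 3) :
    pauliString a * pauliAt k j = pauliString (Function.update a j (some k)) := by
  rw [pauliString, pauliAt, elemTensor_mul, pauliString]
  congr 1
  funext i
  by_cases h : i = j
  · subst h; simp [hj, letter]
  · simp [h]

theorem pauliAt_apply (k : Fin 3) (j : Fin N) (ψ : SpinSpace N) (s : Fin N → Fin 2) :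
    toEuclideanLin (pauliAt k j) ψ s =
      ∑ b : Fin 2, pauli k (s j) b * ψ (Function.update s j b) := by
  rw [toEuclideanLin_apply_apply]
  symm
  refine Finset.sum_of_injOn (fun b => Function.update s j b)
    (Function.update_injective s j).injOn (by simp) ?_ ?_
  · intro t _ ht
    have hne : ∃ i, i ≠ j ∧ s i ≠ t i := by
      by_contra! h
      refine ht ⟨t j, by simp, ?_⟩
      funext i
      by_cases hi : i = j
      · subst hi; simp
      · simp [hi, h i hi]
    obtain ⟨i, hi, hst⟩ := hne
    rw [pauliAt, elemTensor, Matrix.of_apply,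
      Finset.prod_eq_zero (Finset.mem_univ i) (by simp [hi, hst]), zero_mul]
  · intro b _
    rw [pauliAt, elemTensor, Matrix.of_apply,
      Finset.prod_eq_single j (fun i _ hi => by simp [hi]) (by simp)]
    simp

/-! ### Spin flips, permutations of the slots and the mean spin -/

/-- The eigenvalue of `σ₃` on the two basis vectors. -/
def spinSign : Fin 2 → ℝ := ![1, -1]

theorem spinSign_add_one (b : Fin 2) : spinSign (b + 1) = -spinSign b := by
  fin_cases b <;> simp [spinSign]

theorem update_add_one (s : Fin N → Fin 2) (j : Fin N) :
    Function.update s j (s j + 1) = s + Pi.single j 1 := by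
  funext i
  by_cases h : i = j
  · subst h; simp
  · simp [h]

/-- Configurations form a group under addition modulo `2`, in which flipping the spin at `j` is the
translation by `Pi.single j 1`. -/
theorem pauliAt_zero_apply (j : Fin N) (ψ : SpinSpace N) (s : Fin N → Fin 2) :
    toEuclideanLin (pauliAt 0 j) ψ s = ψ (s + Pi.single j 1) := by
  rw [pauliAt_apply, ← update_add_one]
  generalize s j = b
  fin_cases b <;> simp [pauli]

theorem pauliAt_one_apply (j : Fin N) (ψ : SpinSpace N) (s : Fin N → Fin 2) :
    toEuclideanLin (pauliAt 1 j) ψ s =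
      -Complex.I * spinSign (s j) * ψ (s + Pi.single j 1) := by
  rw [pauliAt_apply, ← update_add_one]
  generalize s j = b
  fin_cases b <;> simp [pauli, spinSign]

theorem pauliAt_two_apply (j : Fin N) (ψ : SpinSpace N) (s : Fin N → Fin 2) :
    toEuclideanLin (pauliAt 2 j) ψ s = spinSign (s j) * ψ s := by
  rw [pauliAt_apply]
  conv_rhs => rw [← Function.update_eq_self j s]
  generalize s j = b
  fin_cases b <;> simp [pauli, spinSign]

/-- Reindexing of the spin configurations, as a unitary operator: `(U ψ)(s) = ψ(e s)`. -/
def configUnitary (e : Equiv.Perm (Fin N → Fin 2)) : SpinSpace N ≃ₗᵢ[ℂ] SpinSpace N :=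
  LinearIsometryEquiv.piLpCongrLeft 2 ℂ ℂ e.symm

theorem configUnitary_apply (e : Equiv.Perm (Fin N → Fin 2)) (ψ : SpinSpace N)
    (s : Fin N → Fin 2) : configUnitary e ψ s = ψ (e s) := by
  simp [configUnitary, LinearIsometryEquiv.piLpCongrLeft_apply, Equiv.piCongrLeft'_apply]

/-- The unitary that permutes the tensor factors: `(U_π ψ)(s) = ψ(s ∘ π)`. -/
def permUnitary (π : Equiv.Perm (Fin N)) : SpinSpace N ≃ₗᵢ[ℂ] SpinSpace N :=
  configUnitary (Equiv.arrowCongr π.symm (Equiv.refl (Fin 2)))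

theorem permUnitary_apply (π : Equiv.Perm (Fin N)) (ψ : SpinSpace N) (s : Fin N → Fin 2) :
    permUnitary π ψ s = ψ (s ∘ π) := by
  rw [permUnitary, configUnitary_apply]
  rfl

theorem permUnitary_elemTensor (π : Equiv.Perm (Fin N)) (a : Fin N → M2) (ψ : SpinSpace N) :
    permUnitary π (toEuclideanLin (elemTensor fun i => a (π i)) ψ) =
      toEuclideanLin (elemTensor a) (permUnitary π ψ) := by
  ext s
  simp only [permUnitary_apply, toEuclideanLin_apply_apply]
  refine (Equiv.sum_comp (Equiv.arrowCongr π.symm (Equiv.refl (Fin 2))) _).symm.trans ?_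
  refine Finset.sum_congr rfl fun t _ => ?_
  congr 1
  simp only [elemTensor, Matrix.of_apply]
  exact Equiv.prod_comp π fun i => a i (s i) (t i)

/-- The total spin flip `σ₁ ⊗ ⋯ ⊗ σ₁`, which implements the `ℤ₂`-symmetry. -/
def flipUnitary (N : ℕ) : SpinSpace N ≃ₗᵢ[ℂ] SpinSpace N :=
  configUnitary (Equiv.addRight 1)

theorem flipUnitary_apply (ψ : SpinSpace N) (s : Fin N → Fin 2) :
    flipUnitary N ψ s = ψ (s + 1) := by
  rw [flipUnitary, configUnitary_apply]
  rfl

theorem flipUnitary_pauliAt_zero (j : Fin N) (ψ : SpinSpace N) :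
    flipUnitary N (toEuclideanLin (pauliAt 0 j) ψ) =
      toEuclideanLin (pauliAt 0 j) (flipUnitary N ψ) := by
  ext s
  simp only [flipUnitary_apply, pauliAt_zero_apply, add_right_comm]

theorem flipUnitary_pauliAt_two (j : Fin N) (ψ : SpinSpace N) :
    flipUnitary N (toEuclideanLin (pauliAt 2 j) ψ) =
      -toEuclideanLin (pauliAt 2 j) (flipUnitary N ψ) := by
  ext s
  simp [flipUnitary_apply, pauliAt_two_apply, spinSign_add_one]

theorem permUnitary_pauliAt (π : Equiv.Perm (Fin N)) (k : Fin 3) (j : Fin N) (ψ : SpinSpace N) :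
    permUnitary π (toEuclideanLin (pauliAt k j) ψ) =
      toEuclideanLin (pauliAt k (π j)) (permUnitary π ψ) := by
  rw [pauliAt, pauliAt, ← permUnitary_elemTensor]
  congr 4
  funext i
  by_cases h : i = j
  · subst h; simp
  · simp [h]

/-- The averaged spin operator `S_k = (1/N) ∑_j σ_k(j)`. -/
def meanSpin (N : ℕ) (k : Fin 3) : SpinSpace N →ₗ[ℂ] SpinSpace N :=
  (N : ℂ)⁻¹ • ∑ j : Fin N, toEuclideanLin (pauliAt k j)

theorem meanSpin_apply (k : Fin 3) (ψ : SpinSpace N) :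
    meanSpin N k ψ = (N : ℂ)⁻¹ • ∑ j : Fin N, toEuclideanLin (pauliAt k j) ψ := by
  simp [meanSpin]

theorem inner_meanSpin_left (k : Fin 3) (φ ψ : SpinSpace N) :
    inner ℂ (meanSpin N k φ) ψ = inner ℂ φ (meanSpin N k ψ) := by
  simp only [meanSpin_apply, inner_smul_left, inner_smul_right, sum_inner, inner_sum,
    inner_toEuclideanLin_left (pauliAt_isHermitian k _), map_inv₀, map_natCast]

theorem norm_meanSpin_le (k : Fin 3) (ψ : SpinSpace N) : ‖meanSpin N k ψ‖ ≤ ‖ψ‖ := by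
  rw [meanSpin_apply, norm_smul, norm_inv, RCLike.norm_natCast]
  have h : ‖∑ j : Fin N, toEuclideanLin (pauliAt k j) ψ‖ ≤ N * ‖ψ‖ := by
    refine (norm_sum_le _ _).trans ?_
    simp [norm_pauliAt_apply]
  rcases Nat.eq_zero_or_pos N with rfl | hN
  · simp
  · rw [inv_mul_le_iff₀ (by exact_mod_cast hN)]
    exact h

theorem permUnitary_meanSpin (π : Equiv.Perm (Fin N)) (k : Fin 3) (ψ : SpinSpace N) :
    permUnitary π (meanSpin N k ψ) = meanSpin N k (permUnitary π ψ) := by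
  simp only [meanSpin_apply, map_smul, map_sum, permUnitary_pauliAt]
  congr 1
  exact Equiv.sum_comp π fun j => toEuclideanLin (pauliAt k j) (permUnitary π ψ)

theorem flipUnitary_meanSpin_zero (ψ : SpinSpace N) :
    flipUnitary N (meanSpin N 0 ψ) = meanSpin N 0 (flipUnitary N ψ) := by
  simp only [meanSpin_apply, map_smul, map_sum, flipUnitary_pauliAt_zero]

theorem flipUnitary_meanSpin_two (ψ : SpinSpace N) :
    flipUnitary N (meanSpin N 2 ψ) = -meanSpin N 2 (flipUnitary N ψ) := by
  simp only [meanSpin_apply, map_smul, map_sum, flipUnitary_pauliAt_two,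
    Finset.sum_neg_distrib, smul_neg]

/-! ### Ground states of Hermitian matrices -/

theorem inner_eigenvectorBasis_toEuclideanLin {A : SpinMat N} (hA : A.IsHermitian)
    (i : Fin N → Fin 2) (φ : SpinSpace N) :
    inner ℂ (hA.eigenvectorBasis i) (toEuclideanLin A φ) =
      hA.eigenvalues i * inner ℂ (hA.eigenvectorBasis i) φ := by
  have h : toEuclideanLin A (hA.eigenvectorBasis i) =
      (hA.eigenvalues i : ℂ) • hA.eigenvectorBasis i := by
    ext s
    have := congrFun (hA.mulVec_eigenvectorBasis i) s
    simpa [toEuclideanLin] using this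
  rw [← inner_toEuclideanLin_left hA, h, inner_smul_left, Complex.conj_ofReal]

theorem re_inner_toEuclideanLin_eq_sum {A : SpinMat N} (hA : A.IsHermitian) (φ : SpinSpace N) :
    (inner ℂ φ (toEuclideanLin A φ)).re =
      ∑ i, hA.eigenvalues i * ‖inner ℂ (hA.eigenvectorBasis i) φ‖ ^ 2 := by
  rw [← hA.eigenvectorBasis.sum_inner_mul_inner, Complex.re_sum]
  refine Finset.sum_congr rfl fun i _ => ?_
  rw [inner_eigenvectorBasis_toEuclideanLin, mul_left_comm, Complex.re_ofReal_mul,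
    ← inner_conj_symm φ, Complex.conj_mul']
  norm_cast

/-- The lowest eigenvalue of a Hermitian matrix bounds its quadratic form from below. -/
theorem exists_lowest_eigenvector {A : SpinMat N} (hA : A.IsHermitian) :
    ∃ (E : ℝ) (ψ : SpinSpace N), ‖ψ‖ = 1 ∧ toEuclideanLin A ψ = (E : ℂ) • ψ ∧
      ∀ φ : SpinSpace N, E * ‖φ‖ ^ 2 ≤ (inner ℂ φ (toEuclideanLin A φ)).re := by
  obtain ⟨i, hi⟩ := Finite.exists_min hA.eigenvalues
  refine ⟨hA.eigenvalues i, hA.eigenvectorBasis i, hA.eigenvectorBasis.orthonormal.1 i, ?_, ?_⟩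
  · ext s
    have := congrFun (hA.mulVec_eigenvectorBasis i) s
    simpa [toEuclideanLin] using this
  · intro φ
    rw [re_inner_toEuclideanLin_eq_sum hA, ← hA.eigenvectorBasis.sum_sq_norm_inner_right φ,
      Finset.mul_sum]
    exact Finset.sum_le_sum fun j _ => mul_le_mul_of_nonneg_right (hi j) (sq_nonneg _)

theorem isGroundState_of_forall_le {A : SpinMat N} {E : ℝ} {ψ : SpinSpace N} (hψ : ‖ψ‖ = 1)
    (hE : toEuclideanLin A ψ = (E : ℂ) • ψ)
    (hA : ∀ φ : SpinSpace N, E * ‖φ‖ ^ 2 ≤ (inner ℂ φ (toEuclideanLin A φ)).re) :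
    IsGroundState A ψ := by
  refine ⟨hψ, E, hE, fun μ hμ => ?_⟩
  obtain ⟨v, hv⟩ := hμ.exists_hasEigenvector
  have h := hA v
  rw [hv.apply_eq_smul, inner_smul_right, inner_self_eq_norm_sq_to_K] at h
  have h0 : 0 < ‖v‖ ^ 2 := by have := norm_pos_iff.mpr hv.2; positivity
  have h1 : ((μ : ℂ) * (((‖v‖ : ℝ) : ℂ)) ^ 2).re = μ * ‖v‖ ^ 2 := by
    rw [← Complex.ofReal_pow, ← Complex.ofReal_mul, Complex.ofReal_re]
  exact le_of_mul_le_mul_right (h.trans_eq h1) h0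

theorem IsGroundState.exists_energy {A : SpinMat N} (hA : A.IsHermitian) {ψ : SpinSpace N}
    (hψ : IsGroundState A ψ) :
    ∃ E : ℝ, toEuclideanLin A ψ = (E : ℂ) • ψ ∧
      ∀ φ : SpinSpace N, E * ‖φ‖ ^ 2 ≤ (inner ℂ φ (toEuclideanLin A φ)).re := by
  obtain ⟨-, E, hE, hmin⟩ := hψ
  obtain ⟨E₀, ψ₀, hψ₀, hE₀, hle⟩ := exists_lowest_eigenvector hA
  have h : E ≤ E₀ := hmin E₀ <| Module.End.hasEigenvalue_of_hasEigenvector (x := ψ₀)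
    ⟨Module.End.mem_eigenspace_iff.mpr hE₀, norm_ne_zero_iff.mp (by rw [hψ₀]; exact one_ne_zero)⟩
  exact ⟨E, hE, fun φ => (mul_le_mul_of_nonneg_right h (sq_nonneg _)).trans (hle φ)⟩

/-- A vector that minimizes the quadratic form of a Hermitian matrix is an eigenvector. -/
theorem apply_eq_smul_of_re_inner_le {A : SpinMat N} (hA : A.IsHermitian) {E : ℝ}
    (hE : ∀ φ : SpinSpace N, E * ‖φ‖ ^ 2 ≤ (inner ℂ φ (toEuclideanLin A φ)).re)
    {ψ : SpinSpace N} (hψ : (inner ℂ ψ (toEuclideanLin A ψ)).re ≤ E * ‖ψ‖ ^ 2) :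
    toEuclideanLin A ψ = (E : ℂ) • ψ := by
  have hev : ∀ i, E ≤ hA.eigenvalues i := by
    intro i
    have h := hE (hA.eigenvectorBasis i)
    have h1 : (inner ℂ (hA.eigenvectorBasis i) (hA.eigenvectorBasis i) : ℂ) = 1 := by
      rw [inner_self_eq_norm_sq_to_K, hA.eigenvectorBasis.orthonormal.1 i]; simp
    rw [inner_eigenvectorBasis_toEuclideanLin, h1, hA.eigenvectorBasis.orthonormal.1 i] at h
    simpa using h
  have hsum : ∑ i, (hA.eigenvalues i - E) * ‖inner ℂ (hA.eigenvectorBasis i) ψ‖ ^ 2 = 0 := by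
    refine le_antisymm ?_ (Finset.sum_nonneg fun i _ =>
      mul_nonneg (sub_nonneg.mpr (hev i)) (sq_nonneg _))
    rw [re_inner_toEuclideanLin_eq_sum hA, ← hA.eigenvectorBasis.sum_sq_norm_inner_right ψ,
      Finset.mul_sum] at hψ
    simp only [sub_mul, Finset.sum_sub_distrib]
    exact sub_nonpos.mpr hψ
  rw [Finset.sum_eq_zero_iff_of_nonneg fun i _ =>
    mul_nonneg (sub_nonneg.mpr (hev i)) (sq_nonneg _)] at hsum
  refine hA.eigenvectorBasis.repr.injective (PiLp.ext fun i => ?_)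
  rw [OrthonormalBasis.repr_apply_apply, OrthonormalBasis.repr_apply_apply,
    inner_eigenvectorBasis_toEuclideanLin, inner_smul_right]
  rcases mul_eq_zero.mp (hsum i (Finset.mem_univ i)) with h | h
  · rw [sub_eq_zero.mp h]
  · rw [norm_eq_zero.mp (pow_eq_zero_iff two_ne_zero |>.mp h), mul_zero, mul_zero]

/-! ### Uniqueness of the ground state -/

theorem hamiltonian_apply (B : ℝ) (hN : N ≠ 0) (ψ : SpinSpace N) :
    toEuclideanLin (hamiltonian 1 B N) ψ =
      -((N / 2 : ℝ) : ℂ) • meanSpin N 2 (meanSpin N 2 ψ) -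
        ((N * B : ℝ) : ℂ) • meanSpin N 0 ψ := by
  have h2 : toEuclideanLin (∑ i : Fin N, ∑ j : Fin N, pauliAt 2 i * pauliAt 2 j) ψ =
      ((N : ℂ) * N) • meanSpin N 2 (meanSpin N 2 ψ) := by
    have hN' : (N : ℂ) ≠ 0 := by exact_mod_cast hN
    rw [meanSpin_apply, meanSpin_apply, ← Finset.sum_mul_sum]
    rw [toEuclideanLin_mul]
    simp only [map_sum, LinearMap.sum_apply, map_smul, smul_smul, ← Finset.smul_sum]
    rw [mul_assoc, mul_inv_cancel_left₀ hN', mul_inv_cancel₀ hN', one_smul, Finset.sum_comm]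
  have h0 : toEuclideanLin (∑ j : Fin N, pauliAt 0 j) ψ = (N : ℂ) • meanSpin N 0 ψ := by
    have hN' : (N : ℂ) ≠ 0 := by exact_mod_cast hN
    rw [meanSpin_apply, smul_smul, mul_inv_cancel₀ hN', one_smul, map_sum, LinearMap.sum_apply]
  rw [hamiltonian, map_sub, map_smul, map_smul, LinearMap.sub_apply, LinearMap.smul_apply,
    LinearMap.smul_apply, h2, h0, smul_smul, smul_smul]
  congr 2
  · have hN' : (N : ℂ) ≠ 0 := by exact_mod_cast hN
    push_cast
    field_simp
  · push_cast
    ring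

theorem hamiltonian_isHermitian (B : ℝ) : (hamiltonian 1 B N).IsHermitian := by
  have h : ∀ k, (∑ j : Fin N, pauliAt k j).IsHermitian := fun k => by
    rw [IsHermitian, conjTranspose_sum]
    exact Finset.sum_congr rfl fun j _ => pauliAt_isHermitian k j
  rw [hamiltonian, ← Finset.sum_mul_sum]
  refine IsHermitian.sub ?_ ?_
  · rw [IsHermitian, conjTranspose_smul, conjTranspose_mul, h 2, star_neg]
    congr 2
    exact Complex.conj_ofReal _
  · rw [IsHermitian, conjTranspose_smul, h 0]
    congr 1
    exact Complex.conj_ofReal _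

/-- The mean magnetization `(1/N) ∑_j ±1` of a spin configuration. -/
def magnetization (s : Fin N → Fin 2) : ℝ := (N : ℝ)⁻¹ * ∑ j, spinSign (s j)

theorem meanSpin_two_apply (ψ : SpinSpace N) (s : Fin N → Fin 2) :
    meanSpin N 2 ψ s = magnetization s * ψ s := by
  rw [meanSpin_apply, magnetization]
  simp only [PiLp.smul_apply, WithLp.ofLp_sum, Finset.sum_apply, pauliAt_two_apply, smul_eq_mul,
    ← Finset.sum_mul]
  push_cast
  ring

theorem hamiltonian_apply_apply (B : ℝ) (hN : N ≠ 0) (ψ : SpinSpace N) (s : Fin N → Fin 2) :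
    toEuclideanLin (hamiltonian 1 B N) ψ s =
      -((N / 2 * magnetization s ^ 2 : ℝ) : ℂ) * ψ s -
        B * ∑ j, ψ (s + Pi.single j 1) := by
  have hN' : (N : ℂ) ≠ 0 := by exact_mod_cast hN
  rw [hamiltonian_apply B hN, meanSpin_apply 0]
  simp only [PiLp.sub_apply, PiLp.smul_apply, WithLp.ofLp_sum, Finset.sum_apply,
    meanSpin_two_apply, pauliAt_zero_apply, smul_eq_mul]
  push_cast
  field_simp

/-- The vector of the moduli of the coordinates in the product basis. -/
def absVec (ψ : SpinSpace N) : SpinSpace N := WithLp.toLp 2 fun s => ((‖ψ s‖ : ℝ) : ℂ)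

theorem absVec_apply (ψ : SpinSpace N) (s : Fin N → Fin 2) : absVec ψ s = ((‖ψ s‖ : ℝ) : ℂ) := rfl

theorem norm_absVec (ψ : SpinSpace N) : ‖absVec ψ‖ = ‖ψ‖ := by
  simp [EuclideanSpace.norm_eq, absVec_apply]

theorem re_inner_hamiltonian (B : ℝ) (hN : N ≠ 0) (ψ : SpinSpace N) :
    (inner ℂ ψ (toEuclideanLin (hamiltonian 1 B N) ψ)).re =
      ∑ s, (-(N / 2 * magnetization s ^ 2) * ‖ψ s‖ ^ 2 -
        B * ∑ j, (star (ψ s) * ψ (s + Pi.single j 1)).re) := by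
  rw [PiLp.inner_apply, Complex.re_sum]
  refine Finset.sum_congr rfl fun s _ => ?_
  rw [hamiltonian_apply_apply B hN, RCLike.inner_apply', mul_sub, Complex.sub_re,
    mul_left_comm, Complex.conj_mul', mul_left_comm, Complex.re_ofReal_mul, Finset.mul_sum,
    Complex.re_sum]
  congr 1
  rw [← Complex.ofReal_neg, Complex.re_ofReal_mul]
  norm_cast

theorem re_inner_hamiltonian_absVec_le {B : ℝ} (hB : 0 ≤ B) (hN : N ≠ 0) (ψ : SpinSpace N) :
    (inner ℂ (absVec ψ) (toEuclideanLin (hamiltonian 1 B N) (absVec ψ))).re ≤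
      (inner ℂ ψ (toEuclideanLin (hamiltonian 1 B N) ψ)).re := by
  rw [re_inner_hamiltonian B hN, re_inner_hamiltonian B hN]
  refine Finset.sum_le_sum fun s _ => sub_le_sub (by simp [absVec_apply]) ?_
  refine mul_le_mul_of_nonneg_left (Finset.sum_le_sum fun j _ => ?_) hB
  refine (Complex.re_le_norm _).trans_eq ?_
  simp only [absVec_apply, norm_mul, norm_star]
  rw [Complex.star_def, Complex.conj_ofReal, ← Complex.ofReal_mul, Complex.ofReal_re]

/-- Single spin flips connect all configurations: if the zeros of `ψ` are stable under them, then
one zero coordinate forces `ψ = 0`. -/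
theorem eq_zero_of_spread {ψ : SpinSpace N}
    (h : ∀ s j, ψ s = 0 → ψ (s + Pi.single j 1) = 0) {s : Fin N → Fin 2} (hs : ψ s = 0) :
    ψ = 0 := by
  have key : ∀ (S : Finset (Fin N)) (u : Fin N → Fin 2),
      ψ (s + ∑ j ∈ S, Pi.single j (u j)) = 0 := by
    intro S u
    induction S using Finset.induction_on with
    | empty => simpa using hs
    | insert j S hj ih =>
      rw [Finset.sum_insert hj, add_left_comm, add_comm]
      rcases (show u j = 0 ∨ u j = 1 by generalize u j = b; fin_cases b <;> simp) with hu | hu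
      · rw [hu, Pi.single_zero, add_zero]
        exact ih
      · rw [hu]
        exact h _ j ih
  ext t
  have := key Finset.univ (t - s)
  rwa [Finset.univ_sum_single, add_sub_cancel] at this

/-- Perron-Frobenius: no coordinate of a ground state of the Curie-Weiss Hamiltonian vanishes. The
vector of moduli is a ground state too, and its eigenvalue equation at a zero coordinate forces
the neighbouring coordinates to vanish. -/
theorem IsGroundState.apply_ne_zero {B : ℝ} (hB : 0 < B) (hN : N ≠ 0) {ψ : SpinSpace N}
    (hψ : IsGroundState (hamiltonian 1 B N) ψ) (s : Fin N → Fin 2) : ψ s ≠ 0 := by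
  obtain ⟨E, hE, hle⟩ := hψ.exists_energy (hamiltonian_isHermitian B)
  have hre : (inner ℂ ψ (toEuclideanLin (hamiltonian 1 B N) ψ)).re = E * ‖ψ‖ ^ 2 := by
    rw [hE, inner_smul_right, inner_self_eq_norm_sq_to_K, hψ.1]
    simp
  have habs : toEuclideanLin (hamiltonian 1 B N) (absVec ψ) = (E : ℂ) • absVec ψ := by
    refine apply_eq_smul_of_re_inner_le (hamiltonian_isHermitian B) hle ?_
    rw [norm_absVec, ← hre]
    exact re_inner_hamiltonian_absVec_le hB.le hN ψ
  intro hs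
  refine norm_ne_zero_iff.mp (hψ.1.trans_ne one_ne_zero) (eq_zero_of_spread (fun s j hs => ?_) hs)
  have h := congrArg (fun v : SpinSpace N => v s) habs
  simp only [hamiltonian_apply_apply B hN, PiLp.smul_apply, absVec_apply, hs, norm_zero,
    Complex.ofReal_zero, mul_zero, smul_zero, zero_sub, neg_eq_zero, mul_eq_zero,
    Complex.ofReal_eq_zero, hB.ne', false_or] at h
  have h' : ∑ j, ‖ψ (s + Pi.single j 1)‖ = 0 := by exact_mod_cast h
  rw [Finset.sum_eq_zero_iff_of_nonneg fun _ _ => norm_nonneg _] at h'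
  exact norm_eq_zero.mp (h' j (Finset.mem_univ j))

theorem IsGroundState.exists_eq_smul {B : ℝ} (hB : 0 < B) (hN : N ≠ 0) {ψ φ : SpinSpace N}
    (hψ : IsGroundState (hamiltonian 1 B N) ψ) (hφ : IsGroundState (hamiltonian 1 B N) φ) :
    ∃ c : ℂ, ‖c‖ = 1 ∧ φ = c • ψ := by
  obtain ⟨E, hE, hle⟩ := hψ.exists_energy (hamiltonian_isHermitian B)
  have hφE : toEuclideanLin (hamiltonian 1 B N) φ = (E : ℂ) • φ := by
    refine apply_eq_smul_of_re_inner_le (hamiltonian_isHermitian B) hle ?_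
    obtain ⟨E', hE', hle'⟩ := hφ.exists_energy (hamiltonian_isHermitian B)
    have h := hle' ψ
    rw [hE, inner_smul_right, inner_self_eq_norm_sq_to_K, hψ.1] at h
    rw [hE', inner_smul_right, inner_self_eq_norm_sq_to_K, hφ.1]
    simpa using h
  -- Subtract the multiple of `ψ` that makes one coordinate of the difference vanish.
  set c : ℂ := φ 0 / ψ 0
  have hc : φ = c • ψ := by
    by_contra hne
    have hd : φ - c • ψ ≠ 0 := sub_ne_zero.mpr hne
    have hdE : toEuclideanLin (hamiltonian 1 B N) (φ - c • ψ) = (E : ℂ) • (φ - c • ψ) := by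
      rw [map_sub, map_smul, hE, hφE, smul_sub, smul_comm]
    have hn : (‖φ - c • ψ‖ : ℂ) ≠ 0 := by exact_mod_cast norm_ne_zero_iff.mpr hd
    have hg : IsGroundState (hamiltonian 1 B N) (((‖φ - c • ψ‖ : ℂ)⁻¹) • (φ - c • ψ)) := by
      refine isGroundState_of_forall_le ?_ ?_ hle
      · rw [norm_smul, norm_inv, Complex.norm_real, norm_norm,
          inv_mul_cancel₀ (norm_ne_zero_iff.mpr hd)]
      · rw [map_smul, hdE, smul_comm]
    refine hg.apply_ne_zero hB hN 0 ?_
    have := hψ.apply_ne_zero hB hN 0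
    simp [c, this]
  refine ⟨c, ?_, hc⟩
  have h := congrArg norm hc
  rwa [norm_smul, hφ.1, hψ.1, mul_one, eq_comm] at h

/-- A unitary that commutes with the Hamiltonian multiplies the ground state by a phase. -/
theorem IsGroundState.exists_phase {B : ℝ} (hB : 0 < B) (hN : N ≠ 0) {ψ : SpinSpace N}
    (hψ : IsGroundState (hamiltonian 1 B N) ψ) (U : SpinSpace N ≃ₗᵢ[ℂ] SpinSpace N)
    (hU : U (toEuclideanLin (hamiltonian 1 B N) ψ) = toEuclideanLin (hamiltonian 1 B N) (U ψ)) :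
    ∃ c : ℂ, ‖c‖ = 1 ∧ U ψ = c • ψ := by
  refine hψ.exists_eq_smul hB hN ?_
  obtain ⟨E, hE, hle⟩ := hψ.exists_energy (hamiltonian_isHermitian B)
  refine isGroundState_of_forall_le (by rw [U.norm_map, hψ.1]) ?_ hle
  rw [← hU, hE, map_smul]

theorem permUnitary_hamiltonian (B : ℝ) (hN : N ≠ 0) (π : Equiv.Perm (Fin N)) (ψ : SpinSpace N) :
    permUnitary π (toEuclideanLin (hamiltonian 1 B N) ψ) =
      toEuclideanLin (hamiltonian 1 B N) (permUnitary π ψ) := by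
  simp only [hamiltonian_apply B hN, map_sub, map_smul, permUnitary_meanSpin]

theorem flipUnitary_hamiltonian (B : ℝ) (hN : N ≠ 0) (ψ : SpinSpace N) :
    flipUnitary N (toEuclideanLin (hamiltonian 1 B N) ψ) =
      toEuclideanLin (hamiltonian 1 B N) (flipUnitary N ψ) := by
  simp only [hamiltonian_apply B hN, map_sub, map_smul, flipUnitary_meanSpin_zero,
    flipUnitary_meanSpin_two, map_neg, neg_neg]

/-! ### The Casimir bound -/

/-- `σ₁ ⊗ σ₁ + σ₂ ⊗ σ₂ + σ₃ ⊗ σ₃` is twice the exchange of the two factors minus the identity. -/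
theorem sum_pauliAt_pauliAt {i j : Fin N} (hij : i ≠ j) (φ : SpinSpace N) :
    ∑ k, toEuclideanLin (pauliAt k i) (toEuclideanLin (pauliAt k j) φ) =
      (2 : ℂ) • permUnitary (Equiv.swap i j) φ - φ := by
  ext s
  have hI : ∀ x y w : ℂ, -Complex.I * x * (-Complex.I * y * w) = -(x * y * w) := fun x y w => by
    linear_combination x * y * w * Complex.I_mul_I
  rw [Fin.sum_univ_three]
  simp only [PiLp.add_apply, PiLp.sub_apply, PiLp.smul_apply, permUnitary_apply,
    pauliAt_zero_apply, pauliAt_one_apply, pauliAt_two_apply, smul_eq_mul, Pi.add_apply,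
    Pi.single_eq_of_ne hij.symm, add_zero, hI]
  have hsign : ∀ b : Fin 2, spinSign b * spinSign b = 1 := by
    intro b; fin_cases b <;> simp [spinSign]
  by_cases h : s i = s j
  · have hs : s ∘ Equiv.swap i j = s := by
      funext l
      rcases eq_or_ne l i with rfl | hi
      · simp [h]
      rcases eq_or_ne l j with rfl | hj
      · simp [h]
      simp [Equiv.swap_apply_of_ne_of_ne hi hj]
    rw [hs, h, ← mul_assoc]
    have := hsign (s j)
    have h' : (spinSign (s j) : ℂ) * spinSign (s j) = 1 := by exact_mod_cast this
    rw [h']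
    ring
  · have h01 : ∀ b c : Fin 2, b ≠ c → c = b + 1 := by decide
    have hji := h01 _ _ h
    have hij' := h01 _ _ (Ne.symm h)
    have hs : s ∘ Equiv.swap i j = s + Pi.single i 1 + Pi.single j 1 := by
      funext l
      rcases eq_or_ne l i with rfl | hi
      · simp [hij, hji]
      rcases eq_or_ne l j with rfl | hj
      · simp [hi, hij']
      simp [Equiv.swap_apply_of_ne_of_ne hi hj, hi, hj]
    rw [hs, hji, spinSign_add_one, ← mul_assoc]
    have h' : (spinSign (s i) : ℂ) * spinSign (s i) = 1 := by exact_mod_cast hsign (s i)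
    push_cast
    linear_combination (φ (s + Pi.single i 1 + Pi.single j 1) - φ s) * h'

theorem re_inner_sum_pauliAt_le (i j : Fin N) (φ : SpinSpace N) :
    (inner ℂ φ (∑ k, toEuclideanLin (pauliAt k i) (toEuclideanLin (pauliAt k j) φ))).re ≤
      (if i = j then 3 else 1) * ‖φ‖ ^ 2 := by
  have hself : (inner ℂ φ φ : ℂ).re = ‖φ‖ ^ 2 := inner_self_eq_norm_sq (𝕜 := ℂ) φ
  split_ifs with h
  · subst h
    have h1 : ∀ k, toEuclideanLin (pauliAt k i) (toEuclideanLin (pauliAt k i) φ) = φ := fun k => by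
      rw [← toEuclideanLin_mul, pauliAt_eq_pauliString, pauliString_mul_self,
        toEuclideanLin_one_apply]
    simp only [h1, Fin.sum_univ_three, inner_add_right, Complex.add_re, hself]
    linarith
  · rw [sum_pauliAt_pauliAt h, inner_sub_right, inner_smul_right, Complex.sub_re, hself]
    have h1 : (inner ℂ φ (permUnitary (Equiv.swap i j) φ)).re ≤ ‖φ‖ ^ 2 := by
      refine (Complex.re_le_norm _).trans ((norm_inner_le_norm _ _).trans_eq ?_)
      rw [LinearIsometryEquiv.norm_map, sq]
    have h2 : ((2 : ℂ) * inner ℂ φ (permUnitary (Equiv.swap i j) φ)).re =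
        2 * (inner ℂ φ (permUnitary (Equiv.swap i j) φ)).re := by
      simp
    rw [h2]
    linarith

theorem inner_meanSpin_meanSpin (k : Fin 3) (φ : SpinSpace N) :
    inner ℂ φ (meanSpin N k (meanSpin N k φ)) = ((‖meanSpin N k φ‖ ^ 2 : ℝ) : ℂ) := by
  rw [← inner_meanSpin_left, inner_self_eq_norm_sq_to_K]
  simp

/-- The Casimir bound: the mean spin vector has squared length at most `1 + 2/N`. -/
theorem sum_norm_meanSpin_sq_le (hN : N ≠ 0) (φ : SpinSpace N) :
    ∑ k, ‖meanSpin N k φ‖ ^ 2 ≤ (1 + 2 / N) * ‖φ‖ ^ 2 := by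
  have hN0 : (0 : ℝ) < N := by exact_mod_cast Nat.pos_of_ne_zero hN
  have h1 : ∀ k, ‖meanSpin N k φ‖ ^ 2 = (N : ℝ)⁻¹ * ((N : ℝ)⁻¹ * ∑ i : Fin N, ∑ j : Fin N,
      (inner ℂ φ (toEuclideanLin (pauliAt k i) (toEuclideanLin (pauliAt k j) φ))).re) := fun k => by
    have h := congrArg Complex.re (inner_meanSpin_meanSpin k φ)
    rw [Complex.ofReal_re] at h
    rw [← h, meanSpin_apply k (meanSpin N k φ), meanSpin_apply k φ, inner_smul_right]
    simp only [map_smul, ← Finset.smul_sum, inner_smul_right, map_sum, inner_sum]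
    have hc : ∀ w : ℂ, ((N : ℂ)⁻¹ * w).re = (N : ℝ)⁻¹ * w.re := fun w => by
      rw [← Complex.ofReal_natCast, ← Complex.ofReal_inv, Complex.re_ofReal_mul]
    simp only [hc, Complex.re_sum]
  have h2 : ∑ i : Fin N, ∑ j : Fin N, ∑ k,
      (inner ℂ φ (toEuclideanLin (pauliAt k i) (toEuclideanLin (pauliAt k j) φ))).re ≤
      (N ^ 2 + 2 * N) * ‖φ‖ ^ 2 := by
    calc _ ≤ ∑ i : Fin N, ∑ j : Fin N, (if i = j then (3 : ℝ) else 1) * ‖φ‖ ^ 2 := by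
          refine Finset.sum_le_sum fun i _ => Finset.sum_le_sum fun j _ => ?_
          rw [← Complex.re_sum, ← inner_sum]
          exact re_inner_sum_pauliAt_le i j φ
      _ = (N ^ 2 + 2 * N) * ‖φ‖ ^ 2 := by
          have h3 : ∀ i j : Fin N, (if i = j then (3 : ℝ) else 1) = (if i = j then 2 else 0) + 1 :=
            fun i j => by split_ifs <;> norm_num
          simp only [← Finset.sum_mul, h3, Finset.sum_add_distrib, Finset.sum_ite_eq,
            Finset.mem_univ, if_true, Finset.sum_const, Finset.card_univ, Fintype.card_fin,
            nsmul_eq_mul]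
          ring
  simp only [h1, ← Finset.mul_sum]
  rw [Finset.sum_comm, Finset.sum_congr rfl fun i _ => Finset.sum_comm]
  rw [inv_mul_le_iff₀ hN0, inv_mul_le_iff₀ hN0]
  refine h2.trans_eq ?_
  field_simp

/-! ### The energy of a product state -/

theorem re_inner_hamiltonian_eq (B : ℝ) (hN : N ≠ 0) (φ : SpinSpace N) :
    (inner ℂ φ (toEuclideanLin (hamiltonian 1 B N) φ)).re =
      -(N / 2) * ‖meanSpin N 2 φ‖ ^ 2 - N * B * (inner ℂ φ (meanSpin N 0 φ)).re := by
  rw [hamiltonian_apply B hN, inner_sub_right, inner_smul_right, inner_smul_right,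
    inner_meanSpin_meanSpin, ← Complex.ofReal_neg, Complex.sub_re, Complex.re_ofReal_mul,
    Complex.re_ofReal_mul, Complex.ofReal_re]

/-- The product vector `v ⊗ ⋯ ⊗ v`. -/
def productVec (N : ℕ) (v : Fin 2 → ℂ) : SpinSpace N := WithLp.toLp 2 fun s => ∏ i, v (s i)

theorem inner_productVec_elemTensor (v : Fin 2 → ℂ) (a : Fin N → M2) :
    inner ℂ (productVec N v) (toEuclideanLin (elemTensor a) (productVec N v)) =
      ∏ i, star v ⬝ᵥ (a i).mulVec v := by
  have h : toEuclideanLin (elemTensor a) (productVec N v) =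
      WithLp.toLp 2 fun s => ∏ i, ((a i).mulVec v) (s i) := by
    ext s
    exact congrFun (elemTensor_mulVec a fun _ => v) s
  rw [h, PiLp.inner_apply]
  simp only [dotProduct, productVec, RCLike.inner_apply', map_prod, ← Finset.prod_mul_distrib]
  rw [Finset.prod_univ_sum, Fintype.piFinset_univ]
  rfl

theorem norm_productVec {v : Fin 2 → ℂ} (hv : star v ⬝ᵥ v = 1) : ‖productVec N v‖ = 1 := by
  have h := inner_productVec_elemTensor v (fun _ : Fin N => (1 : M2))
  rw [elemTensor_one, toEuclideanLin_one_apply, inner_self_eq_norm_sq_to_K] at h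
  simp only [one_mulVec, hv, Finset.prod_const_one] at h
  have h' : ‖productVec N v‖ ^ 2 = 1 := by
    have : ((‖productVec N v‖ ^ 2 : ℝ) : ℂ) = 1 := by simpa using h
    exact_mod_cast this
  exact (pow_eq_one_iff_of_nonneg (norm_nonneg _) two_ne_zero).mp h'

theorem inner_productVec_meanSpin (hN : N ≠ 0) {v : Fin 2 → ℂ} (hv : star v ⬝ᵥ v = 1)
    (k : Fin 3) :
    inner ℂ (productVec N v) (meanSpin N k (productVec N v)) =
      star v ⬝ᵥ (pauli k).mulVec v := by
  have h : ∀ j : Fin N, inner ℂ (productVec N v)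
      (toEuclideanLin (pauliAt k j) (productVec N v)) = star v ⬝ᵥ (pauli k).mulVec v := fun j => by
    rw [pauliAt, inner_productVec_elemTensor, Finset.prod_eq_single j]
    · simp
    · intro i _ hi
      simp [hi, hv]
    · simp
  rw [meanSpin_apply, inner_smul_right, inner_sum]
  simp only [h, Finset.sum_const, Finset.card_univ, Fintype.card_fin, nsmul_eq_mul]
  exact inv_mul_cancel_left₀ (by exact_mod_cast hN) _

/-- The product state over a point `(B, 0, z)` of the unit sphere has energy at most
`-N (z²/2 + B²)`, so that `-N (1 + B²)/2` bounds the ground state energy from above. -/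
theorem exists_re_inner_hamiltonian_le {B : ℝ} (hB : B ∈ Set.Ioo (0 : ℝ) 1) (hN : N ≠ 0) :
    ∃ φ : SpinSpace N, ‖φ‖ = 1 ∧
      (inner ℂ φ (toEuclideanLin (hamiltonian 1 B N) φ)).re ≤ -(N * ((1 + B ^ 2) / 2)) := by
  have hz : 0 ≤ 1 - B ^ 2 := by nlinarith [hB.1, hB.2]
  set z := √(1 - B ^ 2)
  have hz2 : z ^ 2 = 1 - B ^ 2 := Real.sq_sqrt hz
  have hz0 : 0 ≤ z := Real.sqrt_nonneg _
  have hz1 : z ≤ 1 := by nlinarith [hB.1]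
  set a := √((1 + z) / 2)
  set b := √((1 - z) / 2)
  have ha : a * a = (1 + z) / 2 := Real.mul_self_sqrt (by linarith)
  have hb : b * b = (1 - z) / 2 := Real.mul_self_sqrt (by linarith)
  have hab : 2 * (a * b) = B := by
    have h1 : a * b = √((B / 2) ^ 2) := by
      rw [← Real.sqrt_mul (by linarith)]
      congr 1
      linear_combination -hz2 / 4
    rw [h1, Real.sqrt_sq (by linarith [hB.1])]
    ring
  have hv : star (![(a : ℂ), (b : ℂ)]) ⬝ᵥ ![(a : ℂ), (b : ℂ)] = 1 := by
    simp only [dotProduct, Fin.sum_univ_two, Pi.star_apply, Complex.star_def]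
    simp only [cons_val_zero, cons_val_one, Complex.conj_ofReal]
    have : a * a + b * b = 1 := by linarith
    exact_mod_cast this
  have h0 := inner_productVec_meanSpin hN hv 0
  have h2 := inner_productVec_meanSpin hN hv 2
  have e0 : star (![(a : ℂ), (b : ℂ)]) ⬝ᵥ (pauli 0).mulVec ![(a : ℂ), (b : ℂ)] = (B : ℂ) := by
    simp only [dotProduct, Fin.sum_univ_two, Pi.star_apply, Complex.star_def, pauli, mulVec]
    simp
    have : a * b + b * a = B := by linarith
    exact_mod_cast this
  have e2 : star (![(a : ℂ), (b : ℂ)]) ⬝ᵥ (pauli 2).mulVec ![(a : ℂ), (b : ℂ)] = (z : ℂ) := by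
    simp only [dotProduct, Fin.sum_univ_two, Pi.star_apply, Complex.star_def, pauli, mulVec]
    simp
    have : a * a - b * b = z := by linarith
    rw [← sub_eq_add_neg]
    exact_mod_cast this
  rw [e0] at h0
  rw [e2] at h2
  refine ⟨productVec N ![(a : ℂ), (b : ℂ)], norm_productVec hv, ?_⟩
  have hn := norm_inner_le_norm (𝕜 := ℂ) (productVec N ![(a : ℂ), (b : ℂ)])
    (meanSpin N 2 (productVec N ![(a : ℂ), (b : ℂ)]))
  rw [h2, norm_productVec hv, one_mul, Complex.norm_real, Real.norm_of_nonneg hz0] at hn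
  rw [re_inner_hamiltonian_eq B hN, h0, Complex.ofReal_re]
  have hsq := pow_le_pow_left₀ hz0 hn 2
  have hN0 : (0 : ℝ) < N := by exact_mod_cast Nat.pos_of_ne_zero hN
  nlinarith

/-! ### Concentration of the mean spin in the ground state -/

/-- In a ground state, the mean spin is close to `(B, 0, ±√(1 - B²))`: eliminating `S₃²` from the
energy by means of the Casimir bound leaves the squares of `S₁ - B` and `S₂`, and the eigenvalue
equation then determines `S₃²`. -/
theorem IsGroundState.norm_meanSpin_sub_le {B : ℝ} (hB : B ∈ Set.Ioo (0 : ℝ) 1) (hN : N ≠ 0)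
    {ψ : SpinSpace N} (hψ : IsGroundState (hamiltonian 1 B N) ψ) :
    ‖meanSpin N 0 ψ - (B : ℂ) • ψ‖ ≤ √(2 / N) ∧ ‖meanSpin N 1 ψ‖ ≤ √(2 / N) ∧
      ‖meanSpin N 2 (meanSpin N 2 ψ) - ((1 - B ^ 2 : ℝ) : ℂ) • ψ‖ ≤ 2 / N + 2 * √(2 / N) := by
  have hN0 : (0 : ℝ) < N := by exact_mod_cast Nat.pos_of_ne_zero hN
  have hnorm := hψ.1
  obtain ⟨E, hE, hle⟩ := hψ.exists_energy (hamiltonian_isHermitian B)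
  obtain ⟨φ, hφ, hφE⟩ := exists_re_inner_hamiltonian_le hB hN
  have hEup : E ≤ -(N * ((1 + B ^ 2) / 2)) := by
    have := (hle φ).trans hφE
    rwa [hφ, one_pow, mul_one] at this
  have hEeq : E = -(N / 2) * ‖meanSpin N 2 ψ‖ ^ 2 - N * B * (inner ℂ ψ (meanSpin N 0 ψ)).re := by
    rw [← re_inner_hamiltonian_eq B hN, hE, inner_smul_right, inner_self_eq_norm_sq_to_K, hnorm]
    simp
  have hcas := sum_norm_meanSpin_sq_le hN ψ
  rw [Fin.sum_univ_three, hnorm, one_pow, mul_one] at hcas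
  have hsub : ‖meanSpin N 0 ψ - (B : ℂ) • ψ‖ ^ 2 =
      ‖meanSpin N 0 ψ‖ ^ 2 - 2 * (B * (inner ℂ ψ (meanSpin N 0 ψ)).re) + B ^ 2 := by
    have h := norm_sub_sq (𝕜 := ℂ) (meanSpin N 0 ψ) ((B : ℂ) • ψ)
    rw [h, norm_smul, hnorm, inner_smul_right, inner_meanSpin_left, Complex.norm_real, mul_one,
      Real.norm_eq_abs, sq_abs]
    simp
  -- The energy per site is `-e`.
  obtain ⟨e, rfl⟩ : ∃ e, E = -(N * e) := ⟨-E / N, by field_simp⟩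
  have he : (1 + B ^ 2) / 2 ≤ e := by
    have : N * ((1 + B ^ 2) / 2) ≤ N * e := by linarith
    exact le_of_mul_le_mul_left this hN0
  have heeq : e = 1 / 2 * ‖meanSpin N 2 ψ‖ ^ 2 + B * (inner ℂ ψ (meanSpin N 0 ψ)).re := by
    refine mul_left_cancel₀ hN0.ne' ?_
    linear_combination -hEeq
  have hdiv : (2 : ℝ) / N = 2 * (1 / N) := by ring
  have hsq0 : ‖meanSpin N 0 ψ - (B : ℂ) • ψ‖ ^ 2 ≤ 2 / N := by
    nlinarith [sq_nonneg ‖meanSpin N 1 ψ‖]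
  have hsq1 : ‖meanSpin N 1 ψ‖ ^ 2 ≤ 2 / N := by
    nlinarith [sq_nonneg ‖meanSpin N 0 ψ - (B : ℂ) • ψ‖]
  have hb0 := Real.le_sqrt_of_sq_le hsq0
  refine ⟨hb0, Real.le_sqrt_of_sq_le hsq1, ?_⟩
  have hup : 2 * e - (1 + B ^ 2) ≤ 2 / N := by
    nlinarith [sq_nonneg ‖meanSpin N 0 ψ - (B : ℂ) • ψ‖, sq_nonneg ‖meanSpin N 1 ψ‖]
  have hvec : meanSpin N 2 (meanSpin N 2 ψ) - ((1 - B ^ 2 : ℝ) : ℂ) • ψ =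
      ((2 * e - (1 + B ^ 2) : ℝ) : ℂ) • ψ -
        ((2 * B : ℝ) : ℂ) • (meanSpin N 0 ψ - (B : ℂ) • ψ) := by
    have hN' : (N : ℂ) ≠ 0 := by exact_mod_cast hN
    rw [hamiltonian_apply B hN] at hE
    have h3 : meanSpin N 2 (meanSpin N 2 ψ) =
        ((2 * e : ℝ) : ℂ) • ψ - ((2 * B : ℝ) : ℂ) • meanSpin N 0 ψ := by
      have h4 := congrArg (fun w => (-(2 / N : ℂ)) • w) hE
      simp only [smul_sub, smul_smul] at h4
      push_cast at h4 ⊢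
      have c1 : (-(2 / N : ℂ)) * -(N / 2) = 1 := by field_simp
      have c2 : (-(2 / N : ℂ)) * (N * B) = -(2 * B) := by field_simp
      have c3 : (-(2 / N : ℂ)) * -(N * e) = 2 * e := by field_simp
      rw [c1, c2, c3, one_smul, neg_smul, sub_neg_eq_add] at h4
      exact eq_sub_of_add_eq h4
    rw [h3]
    push_cast
    module
  rw [hvec]
  refine (norm_sub_le _ _).trans (add_le_add ?_ ?_)
  · rw [norm_smul, hnorm, mul_one, Complex.norm_real, Real.norm_of_nonneg (by linarith)]
    exact hup
  · rw [norm_smul, Complex.norm_real, Real.norm_of_nonneg (by linarith [hB.1])]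
    have hB1 : 2 * B ≤ 2 := by linarith [hB.2]
    exact mul_le_mul hB1 hb0 (norm_nonneg _) zero_le_two

/-! ### Pauli strings in the ground state -/

/-- The slots of a Pauli string that do not carry the identity. -/
def stringSupport (a : Fin N → Option (Fin 3)) : Finset (Fin N) := {i | a i ≠ none}

theorem mem_stringSupport {a : Fin N → Option (Fin 3)} {i : Fin N} :
    i ∈ stringSupport a ↔ a i ≠ none := by
  simp [stringSupport]

theorem stringSupport_update_none (a : Fin N → Option (Fin 3)) (j : Fin N) :
    stringSupport (Function.update a j none) = (stringSupport a).erase j := by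
  ext i
  rw [Finset.mem_erase, mem_stringSupport, mem_stringSupport]
  by_cases h : i = j
  · subst h; simp
  · simp [h]

theorem inner_pauliString_comp {ψ φ : SpinSpace N} {π : Equiv.Perm (Fin N)} {c : ℂ} (hc : ‖c‖ = 1)
    (hψ : permUnitary π ψ = c • ψ) (hφ : permUnitary π φ = c • φ)
    (a : Fin N → Option (Fin 3)) :
    inner ℂ ψ (toEuclideanLin (pauliString (a ∘ π)) φ) =
      inner ℂ ψ (toEuclideanLin (pauliString a) φ) := by
  rw [← (permUnitary π).inner_map_map ψ]
  have h := permUnitary_elemTensor π (fun i => letter (a i)) φ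
  change permUnitary π (toEuclideanLin (pauliString (a ∘ π)) φ) =
    toEuclideanLin (pauliString a) (permUnitary π φ) at h
  rw [h, hψ, hφ, map_smul, inner_smul_left, inner_smul_right, ← mul_assoc, Complex.conj_mul', hc]
  simp

/-- If `ψ` and `φ` transform in the same way under permutations of the slots, then a letter `σ_k`
of a Pauli string between `ψ` and `φ` can be replaced by the mean spin `S_k`: all the free slots
contribute equally to `S_k`, and the occupied ones are few. -/
theorem norm_inner_pauliString_sub_le (hN : N ≠ 0) {ψ φ : SpinSpace N}
    (hinv : ∀ π, ∃ c : ℂ, ‖c‖ = 1 ∧ permUnitary π ψ = c • ψ ∧ permUnitary π φ = c • φ)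
    {a : Fin N → Option (Fin 3)} {j : Fin N} {k : Fin 3} (hj : a j = some k) :
    ‖inner ℂ ψ (toEuclideanLin (pauliString a) φ) -
      inner ℂ ψ (toEuclideanLin (pauliString (Function.update a j none)) (meanSpin N k φ))‖ ≤
      2 * (stringSupport a).card / N * (‖ψ‖ * ‖φ‖) := by
  set b := Function.update a j none with hb
  have hN' : (N : ℂ) ≠ 0 := by exact_mod_cast hN
  have hN0 : (0 : ℝ) < N := by exact_mod_cast Nat.pos_of_ne_zero hN
  have hbj : b j = none := by simp [hb]
  set x : Fin N → ℂ := fun i =>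
    inner ℂ ψ (toEuclideanLin (pauliString b) (toEuclideanLin (pauliAt k i) φ)) with hx
  have hfree : ∀ i, b i = none → x i = inner ℂ ψ (toEuclideanLin (pauliString a) φ) := by
    intro i hi
    obtain ⟨c, hc, hψ, hφ⟩ := hinv (Equiv.swap i j)
    rw [hx]
    dsimp only
    rw [← toEuclideanLin_mul, pauliString_mul_pauliAt hi, ← inner_pauliString_comp hc hψ hφ a]
    congr 4
    funext l
    rcases eq_or_ne l i with rfl | hli
    · simp [hj]
    rcases eq_or_ne l j with rfl | hlj
    · have : a i = none := by simpa [hb, hli.symm] using hi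
      simp [hli, hb, this]
    · simp [Equiv.swap_apply_of_ne_of_ne hli hlj, hli, hb, hlj]
  have hbound : ∀ i, ‖inner ℂ ψ (toEuclideanLin (pauliString a) φ) - x i‖ ≤
      if i ∈ stringSupport b then 2 * (‖ψ‖ * ‖φ‖) else 0 := by
    intro i
    split_ifs with hi
    · refine (norm_sub_le _ _).trans ?_
      have h1 := norm_inner_pauliString_le a ψ φ
      have h2 := norm_inner_pauliString_le b ψ (toEuclideanLin (pauliAt k i) φ)
      rw [norm_pauliAt_apply] at h2
      linarith
    · rw [mem_stringSupport, not_not] at hi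
      rw [hfree i hi, sub_self, norm_zero]
  have hmean : inner ℂ ψ (toEuclideanLin (pauliString a) φ) -
      inner ℂ ψ (toEuclideanLin (pauliString b) (meanSpin N k φ)) =
      (N : ℂ)⁻¹ * ∑ i, (inner ℂ ψ (toEuclideanLin (pauliString a) φ) - x i) := by
    rw [meanSpin_apply, map_smul, inner_smul_right, map_sum, inner_sum, Finset.sum_sub_distrib,
      Finset.sum_const, Finset.card_univ, Fintype.card_fin, nsmul_eq_mul, mul_sub,
      inv_mul_cancel_left₀ hN']
  have hcard : ((stringSupport b).card : ℝ) ≤ (stringSupport a).card := by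
    rw [hb, stringSupport_update_none]
    exact_mod_cast Finset.card_erase_le
  rw [hmean, norm_mul, norm_inv, RCLike.norm_natCast, inv_mul_le_iff₀ hN0]
  calc _ ≤ ∑ i, if i ∈ stringSupport b then 2 * (‖ψ‖ * ‖φ‖) else 0 :=
        norm_sum_le_of_le _ fun i _ => hbound i
    _ = (stringSupport b).card * (2 * (‖ψ‖ * ‖φ‖)) := by
        rw [Finset.sum_ite_mem, Finset.univ_inter, Finset.sum_const, nsmul_eq_mul]
    _ ≤ (stringSupport a).card * (2 * (‖ψ‖ * ‖φ‖)) :=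
        mul_le_mul_of_nonneg_right hcard (by positivity)
    _ = _ := by field_simp

/-- The value at the point `x` of the monomial that corresponds to the Pauli string `a`. -/
def stringValue (x : Fin 3 → ℂ) (a : Fin N → Option (Fin 3)) : ℂ := ∏ i, (a i).elim 1 x

theorem stringValue_eq_mul (x : Fin 3 → ℂ) {a : Fin N → Option (Fin 3)} {j : Fin N} {k : Fin 3}
    (hj : a j = some k) :
    stringValue x a = x k * stringValue x (Function.update a j none) := by
  rw [stringValue, stringValue, ← Finset.mul_prod_erase _ _ (Finset.mem_univ j),
    ← Finset.mul_prod_erase _ (fun i => (Function.update a j none i).elim 1 x)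
      (Finset.mem_univ j), hj]
  simp only [Function.update_self, Option.elim_some, Option.elim_none, one_mul]
  congr 1
  refine Finset.prod_congr rfl fun i hi => ?_
  rw [Function.update_of_ne (Finset.ne_of_mem_erase hi)]

/-- The mean of the values of a monomial at the points `(B, 0, z)` and `(B, 0, -z)`. -/
def limitValue (B z : ℝ) (a : Fin N → Option (Fin 3)) : ℂ :=
  1 / 2 * (stringValue ![(B : ℂ), 0, (z : ℂ)] a + stringValue ![(B : ℂ), 0, -(z : ℂ)] a)

/-- The magnetization `σ₃` vanishes in the ground state, by the spin flip symmetry. -/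
theorem IsGroundState.inner_pauliAt_two {B : ℝ} (hB : 0 < B) (hN : N ≠ 0) {ψ : SpinSpace N}
    (hψ : IsGroundState (hamiltonian 1 B N) ψ) (j : Fin N) :
    inner ℂ ψ (toEuclideanLin (pauliAt 2 j) ψ) = 0 := by
  obtain ⟨c, hc, hcψ⟩ := hψ.exists_phase hB hN (flipUnitary N) (flipUnitary_hamiltonian B hN ψ)
  have h : inner ℂ ψ (toEuclideanLin (pauliAt 2 j) ψ) =
      -inner ℂ ψ (toEuclideanLin (pauliAt 2 j) ψ) := by
    conv_lhs => rw [← (flipUnitary N).inner_map_map ψ, flipUnitary_pauliAt_two, hcψ, map_smul,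
      inner_neg_right, inner_smul_left, inner_smul_right, ← mul_assoc, Complex.conj_mul', hc]
    simp
  exact self_eq_neg.mp h

/-- The expectation of a Pauli string in the ground state is close to its classical value,
uniformly in the string: the letters `σ₁`, `σ₂` and the pairs of letters `σ₃` can be replaced by
`B`, `0` and `1 - B²`, one after the other, and a single remaining `σ₃` contributes nothing. -/
theorem IsGroundState.norm_inner_pauliString_sub_limitValue_le {B : ℝ}
    (hB : B ∈ Set.Ioo (0 : ℝ) 1) (hN : N ≠ 0) {ψ : SpinSpace N}
    (hψ : IsGroundState (hamiltonian 1 B N) ψ) (L : ℕ) (a : Fin N → Option (Fin 3))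
    (ha : (stringSupport a).card ≤ L) :
    ‖inner ℂ ψ (toEuclideanLin (pauliString a) ψ) - limitValue B (√(1 - B ^ 2)) a‖ ≤
      (stringSupport a).card * (4 * L / N + 2 / N + 2 * √(2 / N)) := by
  have hz : 0 ≤ 1 - B ^ 2 := by nlinarith [hB.1, hB.2]
  have hN0 : (0 : ℝ) < N := by exact_mod_cast Nat.pos_of_ne_zero hN
  obtain ⟨h0, h1, h2⟩ := hψ.norm_meanSpin_sub_le hB hN
  have hnorm := hψ.1
  set z := √(1 - B ^ 2) with hzdef
  have hz2 : (z : ℂ) * z = ((1 - B ^ 2 : ℝ) : ℂ) := by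
    rw [← Complex.ofReal_mul, hzdef, Real.mul_self_sqrt hz]
  set η := 4 * L / N + 2 / N + 2 * √(2 / N) with hη
  have hη0 : 0 ≤ η := by positivity
  have hL0 : (0 : ℝ) ≤ L / N := by positivity
  have hperm : ∀ π, ∃ c : ℂ, ‖c‖ = 1 ∧ permUnitary π ψ = c • ψ := fun π =>
    hψ.exists_phase hB.1 hN _ (permUnitary_hamiltonian B hN π ψ)
  -- Replacing one letter of a string with few letters is cheap.
  have hstep : ∀ (b : Fin N → Option (Fin 3)) (φ : SpinSpace N), (stringSupport b).card ≤ L →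
      ‖φ‖ ≤ 1 → (∀ π (c : ℂ), permUnitary π ψ = c • ψ → permUnitary π φ = c • φ) →
      ∀ (j : Fin N) (k : Fin 3), b j = some k →
      ‖inner ℂ ψ (toEuclideanLin (pauliString b) φ) - inner ℂ ψ
        (toEuclideanLin (pauliString (Function.update b j none)) (meanSpin N k φ))‖ ≤
        2 * (L / N) := by
    intro b φ hb hφ hinv j k hj
    refine (norm_inner_pauliString_sub_le hN (fun π => ?_) hj).trans ?_
    · obtain ⟨c, hc, hcψ⟩ := hperm π
      exact ⟨c, hc, hcψ, hinv π c hcψ⟩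
    · rw [hnorm, one_mul, mul_div_assoc, mul_assoc]
      refine mul_le_mul_of_nonneg_left ?_ zero_le_two
      refine (mul_le_of_le_one_right (by positivity) hφ).trans ?_
      gcongr
  have hdiff : ∀ (b : Fin N → Option (Fin 3)) (φ : SpinSpace N) (w : ℂ),
      ‖inner ℂ ψ (toEuclideanLin (pauliString b) φ) -
        w * inner ℂ ψ (toEuclideanLin (pauliString b) ψ)‖ ≤ ‖φ - w • ψ‖ := by
    intro b φ w
    rw [← inner_smul_right, ← inner_sub_right, ← map_smul, ← map_sub]
    simpa only [hnorm, one_mul] using norm_inner_pauliString_le b ψ (φ - w • ψ)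
  obtain ⟨n, hn⟩ : ∃ n, (stringSupport a).card = n := ⟨_, rfl⟩
  induction n using Nat.strong_induction_on generalizing a with
  | _ n ih =>
  have hcard : ∀ (b : Fin N → Option (Fin 3)) (j : Fin N), b j ≠ none →
      (stringSupport (Function.update b j none)).card + 1 = (stringSupport b).card := by
    intro b j hj
    rw [stringSupport_update_none]
    exact Finset.card_erase_add_one (mem_stringSupport.mpr hj)
  have hself : ∀ π (c : ℂ), permUnitary π ψ = c • ψ → permUnitary π ψ = c • ψ := fun _ _ h => h
  by_cases hex0 : ∃ j, a j = some 0
  · obtain ⟨j, hj⟩ := hex0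
    have hc := hcard a j (by simp [hj])
    have hi := ih _ (by omega) (Function.update a j none) (by omega) rfl
    have e1 := hstep a ψ ha hnorm.le hself j 0 hj
    have e2 := hdiff (Function.update a j none) (meanSpin N 0 ψ) B
    have hlim : limitValue B z a = B * limitValue B z (Function.update a j none) := by
      rw [limitValue, limitValue, stringValue_eq_mul _ hj, stringValue_eq_mul _ hj]
      simp only [cons_val_zero]
      ring
    rw [hlim]
    have e3 : ‖(B : ℂ) * inner ℂ ψ (toEuclideanLin (pauliString (Function.update a j none)) ψ) -
        B * limitValue B z (Function.update a j none)‖ ≤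
        (stringSupport (Function.update a j none)).card * η := by
      rw [← mul_sub, norm_mul, Complex.norm_real, Real.norm_of_nonneg hB.1.le]
      exact (mul_le_of_le_one_left (norm_nonneg _) hB.2.le).trans hi
    have hc' : ((stringSupport a).card : ℝ) =
        (stringSupport (Function.update a j none)).card + 1 := by exact_mod_cast hc.symm
    rw [hc', add_mul, one_mul]
    have e4 := norm_sub_le_norm_sub_add_norm_sub
      (inner ℂ ψ (toEuclideanLin (pauliString a) ψ))
      ((B : ℂ) * inner ℂ ψ (toEuclideanLin (pauliString (Function.update a j none)) ψ))
      (B * limitValue B z (Function.update a j none))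
    have e5 := norm_sub_le_norm_sub_add_norm_sub
      (inner ℂ ψ (toEuclideanLin (pauliString a) ψ))
      (inner ℂ ψ (toEuclideanLin (pauliString (Function.update a j none)) (meanSpin N 0 ψ)))
      ((B : ℂ) * inner ℂ ψ (toEuclideanLin (pauliString (Function.update a j none)) ψ))
    have h2N : (0 : ℝ) ≤ 2 / N := by positivity
    have hs := Real.sqrt_nonneg (2 / N : ℝ)
    have hη' : η = 4 * (L / N) + 2 / N + 2 * √(2 / N) := by rw [hη]; ring
    linarith
  by_cases hex1 : ∃ j, a j = some 1
  · obtain ⟨j, hj⟩ := hex1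
    have hc := hcard a j (by simp [hj])
    have e1 := hstep a ψ ha hnorm.le hself j 1 hj
    have e2 := hdiff (Function.update a j none) (meanSpin N 1 ψ) 0
    rw [zero_mul, zero_smul, sub_zero, sub_zero] at e2
    have hlim : limitValue B z a = 0 := by
      rw [limitValue, stringValue_eq_mul _ hj, stringValue_eq_mul _ hj]
      simp
    rw [hlim, sub_zero]
    have hc' : (1 : ℝ) ≤ (stringSupport a).card := by
      have : 1 ≤ (stringSupport a).card := by omega
      exact_mod_cast this
    have e4 := norm_le_norm_sub_add
      (inner ℂ ψ (toEuclideanLin (pauliString a) ψ))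
      (inner ℂ ψ (toEuclideanLin (pauliString (Function.update a j none)) (meanSpin N 1 ψ)))
    have h2N : (0 : ℝ) ≤ 2 / N := by positivity
    have hs := Real.sqrt_nonneg (2 / N : ℝ)
    have hη' : η = 4 * (L / N) + 2 / N + 2 * √(2 / N) := by rw [hη]; ring
    refine le_trans ?_ (le_mul_of_one_le_left hη0 hc')
    linarith
  have htwo : ∀ j, a j ≠ none → a j = some 2 := by
    intro j hj
    obtain ⟨k, hk⟩ := Option.ne_none_iff_exists'.mp hj
    fin_cases k
    · exact absurd ⟨j, hk⟩ hex0
    · exact absurd ⟨j, hk⟩ hex1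
    · exact hk
  by_cases hex : ∃ j, a j ≠ none
  swap
  · -- The empty string is the identity.
    have hnone : a = fun _ => none := by
      funext j
      by_contra h
      exact hex ⟨j, h⟩
    have hone : pauliString a = 1 := by
      rw [hnone, pauliString]
      exact elemTensor_one
    rw [hone, toEuclideanLin_one_apply, inner_self_eq_norm_sq_to_K, hnorm, limitValue]
    have : ∀ x, stringValue x a = 1 := fun x => by rw [stringValue, hnone]; simp
    rw [this, this]
    norm_num
    positivity
  obtain ⟨j, hj⟩ := hex
  have hj2 := htwo j hj
  have hc := hcard a j hj
  by_cases hex' : ∃ i, Function.update a j none i ≠ none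
  · obtain ⟨i, hi⟩ := hex'
    have hij : i ≠ j := by rintro rfl; simp at hi
    have hi2 : Function.update a j none i = some 2 := by
      rw [Function.update_of_ne hij] at hi ⊢
      exact htwo i hi
    set b := Function.update a j none
    have hcb := hcard b i hi
    set d := Function.update b i none
    have hI := ih _ (by omega) d (by omega) rfl
    have e1 := hstep a ψ ha hnorm.le hself j 2 hj2
    have e2 := hstep b (meanSpin N 2 ψ) (by omega) ((norm_meanSpin_le _ _).trans hnorm.le)
      (fun π c hc => by rw [permUnitary_meanSpin, hc, map_smul]) i 2 hi2
    have e3 := hdiff d (meanSpin N 2 (meanSpin N 2 ψ)) ((1 - B ^ 2 : ℝ) : ℂ)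
    have hlim : limitValue B z a = ((1 - B ^ 2 : ℝ) : ℂ) * limitValue B z d := by
      rw [limitValue, limitValue, stringValue_eq_mul _ hj2, stringValue_eq_mul _ hj2,
        stringValue_eq_mul _ hi2, stringValue_eq_mul _ hi2, ← hz2]
      simp only [cons_val]
      ring
    rw [hlim]
    have e4 : ‖((1 - B ^ 2 : ℝ) : ℂ) * inner ℂ ψ (toEuclideanLin (pauliString d) ψ) -
        ((1 - B ^ 2 : ℝ) : ℂ) * limitValue B z d‖ ≤ (stringSupport d).card * η := by
      rw [← mul_sub, norm_mul, Complex.norm_real, Real.norm_of_nonneg hz]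
      exact (mul_le_of_le_one_left (norm_nonneg _) (by nlinarith [hB.1])).trans hI
    have hc' : ((stringSupport a).card : ℝ) = (stringSupport d).card + 1 + 1 := by
      have : (stringSupport a).card = (stringSupport d).card + 1 + 1 := by omega
      exact_mod_cast this
    rw [hc', add_mul, add_mul, one_mul]
    have t1 := norm_sub_le_norm_sub_add_norm_sub
      (inner ℂ ψ (toEuclideanLin (pauliString a) ψ))
      (inner ℂ ψ (toEuclideanLin (pauliString b) (meanSpin N 2 ψ)))
      (((1 - B ^ 2 : ℝ) : ℂ) * limitValue B z d)
    have t2 := norm_sub_le_norm_sub_add_norm_sub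
      (inner ℂ ψ (toEuclideanLin (pauliString b) (meanSpin N 2 ψ)))
      (inner ℂ ψ (toEuclideanLin (pauliString d) (meanSpin N 2 (meanSpin N 2 ψ))))
      (((1 - B ^ 2 : ℝ) : ℂ) * limitValue B z d)
    have t3 := norm_sub_le_norm_sub_add_norm_sub
      (inner ℂ ψ (toEuclideanLin (pauliString d) (meanSpin N 2 (meanSpin N 2 ψ))))
      (((1 - B ^ 2 : ℝ) : ℂ) * inner ℂ ψ (toEuclideanLin (pauliString d) ψ))
      (((1 - B ^ 2 : ℝ) : ℂ) * limitValue B z d)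
    have hη' : η = 4 * (L / N) + 2 / N + 2 * √(2 / N) := by rw [hη]; ring
    linarith
  · -- A single letter `σ₃`.
    have hnone : Function.update a j none = fun _ => none := by
      funext i
      by_contra h
      exact hex' ⟨i, h⟩
    have hstr : pauliString a = pauliAt 2 j := by
      rw [pauliAt_eq_pauliString, ← hnone, Function.update_idem, ← hj2, Function.update_eq_self]
    rw [hstr, hψ.inner_pauliAt_two hB.1 hN, limitValue, stringValue_eq_mul _ hj2,
      stringValue_eq_mul _ hj2, hnone]
    simp [stringValue]
    positivity

/-! ### The quantization map on words -/

theorem norm_average_sub_le {n : ℕ} {x : Equiv.Perm (Fin n) → ℂ} {v : ℂ} {δ : ℝ}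
    (h : ∀ σ, ‖x σ - v‖ ≤ δ) :
    ‖(n.factorial : ℂ)⁻¹ * ∑ σ, x σ - v‖ ≤ δ := by
  have hn : (n.factorial : ℂ) ≠ 0 := by exact_mod_cast n.factorial_ne_zero
  have hn0 : (0 : ℝ) < n.factorial := by exact_mod_cast n.factorial_pos
  have h1 : (n.factorial : ℂ)⁻¹ * ∑ σ, x σ - v = (n.factorial : ℂ)⁻¹ * ∑ σ, (x σ - v) := by
    rw [Finset.sum_sub_distrib, Finset.sum_const, Finset.card_univ, Fintype.card_perm,
      Fintype.card_fin, nsmul_eq_mul, mul_sub, inv_mul_cancel_left₀ hn]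
  rw [h1, norm_mul, norm_inv, RCLike.norm_natCast, inv_mul_le_iff₀ hn0]
  refine (norm_sum_le_of_le _ fun σ _ => h σ).trans_eq ?_
  rw [Finset.sum_const, Finset.card_univ, Fintype.card_perm, Fintype.card_fin, nsmul_eq_mul]

/-- The Pauli string that starts with the letters `f 0, f 1, …` and continues with identities. -/
def paddedString (N : ℕ) {L : ℕ} (f : Fin L → Fin 3) : Fin N → Option (Fin 3) :=
  fun i => if hi : i.val < L then some (f ⟨i.val, hi⟩) else none

theorem card_stringSupport_paddedString_comp_le {L : ℕ} (f : Fin L → Fin 3)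
    (π : Equiv.Perm (Fin N)) : (stringSupport (paddedString N f ∘ π)).card ≤ L := by
  refine (Finset.card_le_card_of_injOn (t := Finset.range L) (fun i => (π i).val)
    (fun i hi => ?_) (fun i _ i' _ h => π.injective (Fin.ext h))).trans_eq (Finset.card_range L)
  rw [Finset.mem_coe, mem_stringSupport] at hi
  rw [Finset.mem_coe, Finset.mem_range]
  by_contra h
  exact hi (dif_neg h)

theorem stringValue_paddedString_comp {L : ℕ} (hL : L ≤ N) (x : Fin 3 → ℂ) (f : Fin L → Fin 3)
    (π : Equiv.Perm (Fin N)) : stringValue x (paddedString N f ∘ π) = ∏ i, x (f i) := by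
  rw [stringValue]
  refine (Equiv.prod_comp π fun i => (paddedString N f i).elim 1 x).trans ?_
  obtain ⟨m, rfl⟩ := Nat.exists_eq_add_of_le hL
  rw [Fin.prod_univ_add]
  simp [paddedString]

theorem quantizeWord_eq {l : List (Fin 3)} (h : l.length ≤ N) :
    quantizeWord N l = (l.length.factorial : ℂ)⁻¹ • ∑ τ : Equiv.Perm (Fin l.length),
      (N.factorial : ℂ)⁻¹ • ∑ π : Equiv.Perm (Fin N),
        pauliString (paddedString N (fun i => l.get (τ i)) ∘ π) := by
  have hpad : ∀ (c : ℂ) (b : Equiv.Perm (Fin l.length) → SpinMat l.length),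
      padOne h (c • ∑ τ, b τ) = c • ∑ τ, padOne h (b τ) := by
    intro c b
    ext s t
    simp only [padOne, Matrix.of_apply, Matrix.smul_apply, Matrix.sum_apply, smul_eq_mul,
      Finset.mul_sum, Finset.sum_mul, mul_assoc]
  rw [quantizeWord, dif_pos h, symmetrizerFrom, symmetrizer_elemTensor, hpad, map_smul, map_sum]
  congr 1
  refine Finset.sum_congr rfl fun τ _ => ?_
  rw [padOne_elemTensor, symmetrizer_elemTensor]
  congr 1
  refine Finset.sum_congr rfl fun π _ => ?_
  rw [pauliString]
  congr 1
  funext i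
  simp only [Function.comp_apply, paddedString]
  split_ifs <;> rfl

theorem IsGroundState.norm_inner_quantizeWord_sub_le {B : ℝ} (hB : B ∈ Set.Ioo (0 : ℝ) 1)
    (hN : N ≠ 0) {ψ : SpinSpace N} (hψ : IsGroundState (hamiltonian 1 B N) ψ)
    {l : List (Fin 3)} (hl : l.length ≤ N) :
    ‖inner ℂ ψ (toEuclideanLin (quantizeWord N l) ψ) -
      1 / 2 * ((l.map ![(B : ℂ), 0, (√(1 - B ^ 2) : ℂ)]).prod +
        (l.map ![(B : ℂ), 0, -(√(1 - B ^ 2) : ℂ)]).prod)‖ ≤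
      l.length * (4 * l.length / N + 2 / N + 2 * √(2 / N)) := by
  rw [quantizeWord_eq hl]
  simp only [map_smul, map_sum, LinearMap.smul_apply, LinearMap.sum_apply, inner_smul_right,
    inner_sum]
  refine norm_average_sub_le fun τ => norm_average_sub_le fun π => ?_
  have hcard := card_stringSupport_paddedString_comp_le (fun i => l.get (τ i)) π
  have hprod : ∀ x : Fin 3 → ℂ,
      stringValue x (paddedString N (fun i => l.get (τ i)) ∘ π) = (l.map x).prod := fun x => by
    rw [stringValue_paddedString_comp hl, Equiv.prod_comp τ fun i => x (l.get i),
      ← List.prod_ofFn]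
    congr 1
    exact (List.ofFn_comp' l.get x).trans (by rw [List.ofFn_get])
  have h := hψ.norm_inner_pauliString_sub_limitValue_le hB hN l.length _ hcard
  rw [limitValue, hprod, hprod] at h
  refine h.trans (mul_le_mul_of_nonneg_right (by exact_mod_cast hcard) (by positivity))

/-! ### The classical limit -/

theorem tendsto_inner_quantizeWord {B : ℝ} (hB : B ∈ Set.Ioo (0 : ℝ) 1)
    {Ψ : (N : ℕ) → SpinSpace N}
    (hΨ : ∀ N : ℕ, 1 ≤ N → IsGroundState (hamiltonian 1 B N) (Ψ N)) (l : List (Fin 3)) :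
    Tendsto (fun N : ℕ => inner ℂ (Ψ N) (toEuclideanLin (quantizeWord N l) (Ψ N))) atTop
      (𝓝 (1 / 2 * ((l.map ![(B : ℂ), 0, (√(1 - B ^ 2) : ℂ)]).prod +
        (l.map ![(B : ℂ), 0, -(√(1 - B ^ 2) : ℂ)]).prod))) := by
  have hlim : Tendsto (fun N : ℕ => (l.length : ℝ) *
      (4 * l.length / N + 2 / N + 2 * √(2 / N))) atTop (𝓝 0) := by
    have h1 := tendsto_const_div_atTop_nhds_zero_nat (4 * l.length : ℝ)
    have h2 := tendsto_const_div_atTop_nhds_zero_nat (2 : ℝ)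
    have h3 := (h2.sqrt.const_mul 2)
    simpa using ((h1.add h2).add h3).const_mul (l.length : ℝ)
  refine tendsto_iff_norm_sub_tendsto_zero.mpr (squeeze_zero' (by simp) ?_ hlim)
  filter_upwards [eventually_ge_atTop (max 1 l.length)] with N hN
  have h1 : 1 ≤ N := (le_max_left _ _).trans hN
  exact (hΨ N h1).norm_inner_quantizeWord_sub_le hB (by omega) ((le_max_right _ _).trans hN)

theorem monomial_eq_smul_prod (α : Fin 3 →₀ ℕ) (c : ℂ) :
    MvPolynomial.monomial α c =
      c • ((Finsupp.toMultiset α).toList.map (MvPolynomial.X : Fin 3 → _)).prod := by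
  rw [← Multiset.prod_coe, ← Multiset.map_coe, Multiset.coe_toList, Finsupp.toMultiset_map,
    Finsupp.prod_toMultiset, MvPolynomial.monomial_eq, MvPolynomial.smul_eq_C_mul,
    Finsupp.prod_mapDomain_index (fun _ => pow_zero _) (fun _ _ _ => pow_add _ _ _)]

theorem tendsto_inner_quantize {B : ℝ} (hB : B ∈ Set.Ioo (0 : ℝ) 1)
    {Ψ : (N : ℕ) → SpinSpace N}
    (hΨ : ∀ N : ℕ, 1 ≤ N → IsGroundState (hamiltonian 1 B N) (Ψ N))
    (f : MvPolynomial (Fin 3) ℂ) :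
    Tendsto (fun N : ℕ => inner ℂ (Ψ N) (toEuclideanLin (quantize N f) (Ψ N))) atTop
      (𝓝 (1 / 2 * (polyFun f (xPlus B hB) + polyFun f (xMinus B hB)))) := by
  induction f using MvPolynomial.induction_on' with
  | monomial α c =>
    have hp : ∀ x : Ball3, polyFun (MvPolynomial.monomial α c) x =
        c * ((Finsupp.toMultiset α).toList.map fun i => ((x.1 i : ℝ) : ℂ)).prod := fun x => by
      rw [polyFun, ContinuousMap.coe_mk, monomial_eq_smul_prod, MvPolynomial.smul_eval,
        map_list_prod, List.map_map]
      congr 3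
      funext i
      simp
    have hplus : (fun i => (((xPlus B hB).1 i : ℝ) : ℂ)) = ![(B : ℂ), 0, (√(1 - B ^ 2) : ℂ)] := by
      funext i
      fin_cases i <;> simp [xPlus]
    have hminus : (fun i => (((xMinus B hB).1 i : ℝ) : ℂ)) =
        ![(B : ℂ), 0, -(√(1 - B ^ 2) : ℂ)] := by
      funext i
      fin_cases i <;> simp [xMinus]
    have h := (tendsto_inner_quantizeWord hB hΨ (Finsupp.toMultiset α).toList).const_mul c
    rw [hp, hp, hplus, hminus, ← mul_add, mul_left_comm]
    refine h.congr fun N => ?_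
    rw [monomial_eq_smul_prod, map_smul, quantize_word, map_smul, LinearMap.smul_apply,
      inner_smul_right]
  | add p q hp hq =>
    have hadd : ∀ x, polyFun (p + q) x = polyFun p x + polyFun q x := fun x => by
      simp [polyFun]
    rw [hadd, hadd, show (1 / 2 : ℂ) * (polyFun p (xPlus B hB) + polyFun q (xPlus B hB) +
      (polyFun p (xMinus B hB) + polyFun q (xMinus B hB))) =
      1 / 2 * (polyFun p (xPlus B hB) + polyFun p (xMinus B hB)) +
      1 / 2 * (polyFun q (xPlus B hB) + polyFun q (xMinus B hB)) by ring]
    refine (hp.add hq).congr fun N => ?_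
    rw [map_add, map_add, LinearMap.add_apply, inner_add_right]

/-! ### The classical ground states -/

theorem xPlus_ne_xMinus {B : ℝ} (hB : B ∈ Set.Ioo (0 : ℝ) 1) : xPlus B hB ≠ xMinus B hB := by
  intro h
  have hz : 0 < √(1 - B ^ 2) := Real.sqrt_pos.mpr (by nlinarith [hB.1, hB.2])
  have h2 := congrArg (fun p : Ball3 => p.1 2) h
  simp only [xPlus, xMinus, PiLp.toLp_apply, cons_val] at h2
  linarith

/-- On the unit ball, `h + (1 + B²)/2 ≥ ((x - B)² + y²)/2`, with equality on the sphere. -/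
theorem setOf_isMin_classicalHamiltonian {B : ℝ} (hB : B ∈ Set.Ioo (0 : ℝ) 1) :
    {p : Ball3 | ∀ q, classicalHamiltonian 1 B p ≤ classicalHamiltonian 1 B q} =
      {xPlus B hB, xMinus B hB} := by
  have hz : 0 ≤ 1 - B ^ 2 := by nlinarith [hB.1, hB.2]
  have hz2 : √(1 - B ^ 2) ^ 2 = 1 - B ^ 2 := Real.sq_sqrt hz
  have hball : ∀ p : Ball3, p.1 0 ^ 2 + p.1 1 ^ 2 + p.1 2 ^ 2 ≤ 1 := fun p => by
    have h := mem_closedBall_zero_iff.mp p.2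
    rw [EuclideanSpace.norm_eq, Real.sqrt_le_iff] at h
    simpa [Fin.sum_univ_three] using h.2
  have hplus : classicalHamiltonian 1 B (xPlus B hB) = -((1 + B ^ 2) / 2) := by
    simp only [classicalHamiltonian, xPlus, PiLp.toLp_apply, cons_val]
    rw [hz2]
    ring
  have hminus : classicalHamiltonian 1 B (xMinus B hB) = -((1 + B ^ 2) / 2) := by
    simp only [classicalHamiltonian, xMinus, PiLp.toLp_apply, cons_val]
    rw [neg_sq, hz2]
    ring
  have hle : ∀ q, -((1 + B ^ 2) / 2) ≤ classicalHamiltonian 1 B q := fun q => by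
    rw [classicalHamiltonian]
    nlinarith [hball q, sq_nonneg (q.1 0 - B), sq_nonneg (q.1 1)]
  ext p
  simp only [Set.mem_ofPred_eq, Set.mem_insert_iff, Set.mem_singleton_iff]
  constructor
  · intro h
    have h1 := h (xPlus B hB)
    rw [hplus, classicalHamiltonian] at h1
    have hb := hball p
    have h0 : p.1 0 = B := by
      have : (p.1 0 - B) ^ 2 = 0 := by
        nlinarith [sq_nonneg (p.1 0 - B), sq_nonneg (p.1 1)]
      exact sub_eq_zero.mp (pow_eq_zero_iff two_ne_zero |>.mp this)
    have hy : p.1 1 = 0 := by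
      have : (p.1 1) ^ 2 = 0 := by
        nlinarith [sq_nonneg (p.1 0 - B), sq_nonneg (p.1 1)]
      exact pow_eq_zero_iff two_ne_zero |>.mp this
    rw [h0] at h1 hb
    have hzz : p.1 2 ^ 2 = √(1 - B ^ 2) ^ 2 := by
      rw [hz2]
      nlinarith [sq_nonneg (p.1 1)]
    rcases sq_eq_sq_iff_eq_or_eq_neg.mp hzz with h2 | h2
    · left
      ext i
      fin_cases i
      · simpa [xPlus] using h0
      · simpa [xPlus] using hy
      · simpa [xPlus] using h2
    · right
      ext i
      fin_cases i
      · simpa [xMinus] using h0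
      · simpa [xMinus] using hy
      · simpa [xMinus] using h2
  · rintro (rfl | rfl) q
    · rw [hplus]; exact hle q
    · rw [hminus]; exact hle q

theorem evalCLM_mem_states (p : Ball3) :
    (ContinuousMap.evalCLM ℂ p : C(Ball3, ℂ) →L[ℂ] ℂ) ∈ states := by
  refine ⟨rfl, fun f => ?_⟩
  have h : (ContinuousMap.evalCLM ℂ p : C(Ball3, ℂ) →L[ℂ] ℂ) (star f * f) =
      ((‖f p‖ ^ 2 : ℝ) : ℂ) := by
    have : (ContinuousMap.evalCLM ℂ p : C(Ball3, ℂ) →L[ℂ] ℂ) (star f * f) =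
      starRingEnd ℂ (f p) * f p := rfl
    rw [this, Complex.conj_mul']
    push_cast
    rfl
  rw [h]
  exact ⟨by rw [Complex.ofReal_re]; positivity, Complex.ofReal_im _⟩

theorem convex_states : Convex ℝ states := by
  intro ω hω ω' hω' a b ha hb hab
  refine ⟨?_, fun f => ?_⟩
  · simp only [_root_.add_apply, _root_.smul_apply, hω.1, hω'.1]
    rw [← add_smul, hab, one_smul]
  · simp only [_root_.add_apply, _root_.smul_apply, Complex.add_re,
      Complex.add_im, Complex.smul_re, Complex.smul_im, smul_eq_mul, (hω.2 f).2, (hω'.2 f).2]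
    exact ⟨add_nonneg (mul_nonneg ha (hω.2 f).1) (mul_nonneg hb (hω'.2 f).1), by simp⟩

theorem evalCLM_injective :
    Function.Injective fun p : Ball3 => (ContinuousMap.evalCLM ℂ p : C(Ball3, ℂ) →L[ℂ] ℂ) := by
  intro p q h
  ext i
  have := DFunLike.congr_fun h (polyFun (MvPolynomial.X i))
  have h' : (polyFun (MvPolynomial.X i)) p = (polyFun (MvPolynomial.X i)) q := this
  simpa [polyFun] using h'

theorem parity_xPlus {B : ℝ} (hB : B ∈ Set.Ioo (0 : ℝ) 1) : parity (xPlus B hB) = xMinus B hB := by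
  ext i
  fin_cases i <;> simp [parity, xPlus, xMinus]

theorem parity_xMinus {B : ℝ} (hB : B ∈ Set.Ioo (0 : ℝ) 1) : parity (xMinus B hB) = xPlus B hB := by
  ext i
  fin_cases i <;> simp [parity, xPlus, xMinus]

/-- The equal mixture of the Dirac measures at the two minimizers, which parity interchanges. -/
theorem exists_mixed_classicalGroundState {B : ℝ} (hB : B ∈ Set.Ioo (0 : ℝ) 1) :
    ∃ ω : C(Ball3, ℂ) →L[ℂ] ℂ,
      (∀ g, ω g = 1 / 2 * (g (xPlus B hB) + g (xMinus B hB))) ∧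
      ω ∈ states ∧ ω ∈ classicalGroundStates 1 B ∧
      (∀ g, ω (g.comp parity) = ω g) ∧
      ω ∉ Set.extremePoints ℝ states := by
  set δp : C(Ball3, ℂ) →L[ℂ] ℂ := ContinuousMap.evalCLM ℂ (xPlus B hB) with hp
  set δm : C(Ball3, ℂ) →L[ℂ] ℂ := ContinuousMap.evalCLM ℂ (xMinus B hB) with hm
  have hval : ∀ g, ((1 / 2 : ℝ) • δp + (1 / 2 : ℝ) • δm) g =
      1 / 2 * (g (xPlus B hB) + g (xMinus B hB)) := fun g => by
    simp only [_root_.add_apply, _root_.smul_apply, hp, hm,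
      ContinuousMap.evalCLM_apply, Complex.real_smul]
    push_cast
    ring
  refine ⟨(1 / 2 : ℝ) • δp + (1 / 2 : ℝ) • δm, hval, ?_, ?_, fun g => ?_, fun hext => ?_⟩
  · exact convex_states (evalCLM_mem_states _) (evalCLM_mem_states _) (by norm_num) (by norm_num)
      (by norm_num)
  · have hconv : Convex ℝ (classicalGroundStates 1 B) := convex_convexHull ℝ _
    have hmem : ∀ p : Ball3, p = xPlus B hB ∨ p = xMinus B hB →
        (ContinuousMap.evalCLM ℂ p : C(Ball3, ℂ) →L[ℂ] ℂ) ∈ classicalGroundStates 1 B := by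
      intro p hpm
      rw [classicalGroundStates, setOf_isMin_classicalHamiltonian hB]
      exact subset_convexHull ℝ _ (Set.mem_image_of_mem _ hpm)
    exact hconv (hmem _ (Or.inl rfl)) (hmem _ (Or.inr rfl)) (by norm_num) (by norm_num)
      (by norm_num)
  · rw [hval, hval, ContinuousMap.comp_apply, ContinuousMap.comp_apply, parity_xPlus,
      parity_xMinus, add_comm]
  · have hseg : (1 / 2 : ℝ) • δp + (1 / 2 : ℝ) • δm ∈ openSegment ℝ δp δm :=
      ⟨1 / 2, 1 / 2, by norm_num, by norm_num, by norm_num, rfl⟩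
    have h := mem_extremePoints.mp hext
    obtain ⟨h1, h2⟩ := h.2 _ (evalCLM_mem_states _) _ (evalCLM_mem_states _) hseg
    exact xPlus_ne_xMinus hB (evalCLM_injective (h1.trans h2.symm))

end CurieWeiss

end

open CurieWeiss in
theorem theorem4p2 (B : ℝ) (hB : B ∈ Set.Ioo (0 : ℝ) 1) :
    -- for every `N ≥ 1` the ground state exists and is unique up to a phase
    (∀ N : ℕ, 1 ≤ N → ∃ ψ : SpinSpace N, IsGroundState (hamiltonian 1 B N) ψ ∧
      ∀ φ : SpinSpace N, IsGroundState (hamiltonian 1 B N) φ →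
        ∃ c : ℂ, ‖c‖ = 1 ∧ φ = c • ψ) ∧
    -- the absolute minima of the classical Hamiltonian are attained exactly at `x₊ ≠ x₋`
    ({p : Ball3 | ∀ q, classicalHamiltonian 1 B p ≤ classicalHamiltonian 1 B q} =
      {xPlus B hB, xMinus B hB}) ∧
    xPlus B hB ≠ xMinus B hB ∧
    -- the classical limit of the ground states
    (∀ Ψ : (N : ℕ) → SpinSpace N,
      (∀ N : ℕ, 1 ≤ N → IsGroundState (hamiltonian 1 B N) (Ψ N)) →
      ∀ f : MvPolynomial (Fin 3) ℂ,
        Tendsto (fun N : ℕ => inner ℂ (Ψ N) (Matrix.toEuclideanLin (quantize N f) (Ψ N))) atTop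
          (𝓝 (1 / 2 * (polyFun f (xPlus B hB) + polyFun f (xMinus B hB))))) ∧
    -- the limit defines a mixed, `ℤ₂`-invariant classical ground state
    (∃ ω : C(Ball3, ℂ) →L[ℂ] ℂ,
      (∀ g, ω g = 1 / 2 * (g (xPlus B hB) + g (xMinus B hB))) ∧
      ω ∈ states ∧ ω ∈ classicalGroundStates 1 B ∧
      (∀ g, ω (g.comp parity) = ω g) ∧
      ω ∉ Set.extremePoints ℝ states) := by
  refine ⟨fun N hN => ?_, setOf_isMin_classicalHamiltonian hB, xPlus_ne_xMinus hB,
    fun Ψ hΨ f => tendsto_inner_quantize hB hΨ f, exists_mixed_classicalGroundState hB⟩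
  obtain ⟨E, ψ, hψ, hE, hle⟩ := exists_lowest_eigenvector (hamiltonian_isHermitian (N := N) B)
  have hg := isGroundState_of_forall_le hψ hE hle
  exact ⟨ψ, hg, fun φ hφ => hg.exists_eq_smul hB.1 (by omega) hφ⟩
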